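/- Let $1<\alpha<\tfrac32$, and let $c_1,c_2$ be constants with $c_1>16\alpha$ and $0<10\,c_2\ln 2<2\alpha-2$. For $S\ge 1$ let $\mathcal M_S$ be the set of probability vectors $P=(p_1,\dots,p_S)$ and put $F_\alpha(P)=\sum_{i=1}^S p_i^\alpha$. Poissonized model with sample size $n$: one observes independent counts $Z_i\sim\mathrm{Poi}(np_i)$, $1\le i\le S$. Given $Z=(Z_1,\dots,Z_S)$, draw conditionally independent $X_i\sim \mathrm{B}(Z_i,1/2)$ and set $Y_i=Z_i-X_i$. Estimator: write $m=n/2$, $\hat p_{i,1}=X_i/m$, $\hat p_{i,2}=Y_i/m$, $\Delta=c_1\ln m/m$, $K=\lfloor c_2\ln m\rfloor$, $t=\Delta/4$. Let $\sum_{k=0}^K g_k x^k$ be the best uniform approximation of $x^\alpha$ on $[0,1]$ by polynomials of degree at most $K$, and define $$S_{K,\alpha}(x)=\sum_{k=1}^K g_k(4\Delta)^{-k+\alpha}\prod_{r=0}^{k-1}\Big(x-\frac rm\Big),\qquad L_\alpha(x)=\min\{S_{K,\alpha}(x),1\},$$ $$U_\alpha(x)=I(x)\Big(1+\frac{\alpha(1-\alpha)}{2mx}\Big)x^\alpha,$$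 where $I(x)=0$ for $x\le t$, $I(x)=1$ for $x\ge 2t$ and $I(x)=g\big((x-t)/t\big)$ for $t<x<2t$, with $g(u)=126u^5-420u^6+540u^7-315u^8+70u^9$. Put $$\hat F_\alpha=\sum_{i=1}^S\Big[L_\alpha(\hat p_{i,1})\mathbf 1(\hat p_{i,2}\le 2\Delta)+U_\alpha(\hat p_{i,1})\mathbf 1(\hat p_{i,2}>2\Delta)\Big].$$ Then $$\limsup_{n\to\infty}\,(n\ln n)^{2(\alpha-1)}\cdot\sup_{S}\sup_{P\in\mathcal M_S}\mathbb E_P\big(\hat F_\alpha-F_\alpha(P)\big)^2<\infty .$$ -/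

import Mathlib

open MeasureTheory ProbabilityTheory Filter
open scoped ENNReal NNReal

noncomputable section

namespace PowerSumEstimation

/-! ### Best uniform polynomial approximation on the unit interval -/

/-- The uniform distance on `[0,1]` between a polynomial and a function. -/
def unifDist (f : ℝ → ℝ) (Q : Polynomial ℝ) : ℝ :=
  ⨆ x : Set.Icc (0 : ℝ) 1, |Q.eval (x : ℝ) - f x|

/-- `Q` is a best uniform approximation of `f` on `[0,1]` among the polynomials of degree at
most `K`. -/
def IsBestApprox (f : ℝ → ℝ) (K : ℕ) (Q : Polynomial ℝ) : Prop :=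
  Q.natDegree ≤ K ∧ ∀ R : Polynomial ℝ, R.natDegree ≤ K → unifDist f Q ≤ unifDist f R

/-- A best approximation of a function that is continuous on `[0,1]` exists. -/
theorem exists_isBestApprox {f : ℝ → ℝ} (hf : ContinuousOn f (Set.Icc 0 1)) (K : ℕ) :
    ∃ Q : Polynomial ℝ, IsBestApprox f K Q := by
  let g : C(Set.Icc (0 : ℝ) 1, ℝ) := ⟨fun x => f x, hf.domRestrict⟩
  let T : Polynomial ℝ →ₗ[ℝ] C(Set.Icc (0 : ℝ) 1, ℝ) :=
    (Polynomial.toContinuousMapOnAlgHom (Set.Icc (0 : ℝ) 1)).toLinearMap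
  have hT : ∀ Q : Polynomial ℝ, unifDist f Q = ‖T Q - g‖ := by
    intro Q
    rw [ContinuousMap.norm_eq_iSup_norm]
    rfl
  have hdeg : ∀ Q : Polynomial ℝ, Q ∈ Polynomial.degreeLE ℝ (K : WithBot ℕ) ↔
      Q.natDegree ≤ K := by
    intro Q
    rw [Polynomial.mem_degreeLE, Polynomial.natDegree_le_iff_degree_le]
  have hfin : Module.Finite ℝ (Polynomial.degreeLE ℝ (K : WithBot ℕ)) := by
    rw [Polynomial.degreeLE_eq_span_X_pow]
    exact Module.Finite.span_of_finite ℝ (Finset.finite_toSet _)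
  let E : Submodule ℝ C(Set.Icc (0 : ℝ) 1, ℝ) :=
    (Polynomial.degreeLE ℝ (K : WithBot ℕ)).map T
  have hE : FiniteDimensional ℝ E := Module.Finite.map _ _
  have hprop : ProperSpace E := FiniteDimensional.proper_real E
  have hcont : Continuous fun e : E => ‖(e : C(Set.Icc (0 : ℝ) 1, ℝ)) - g‖ := by fun_prop
  have hlim : Tendsto (fun e : E => ‖(e : C(Set.Icc (0 : ℝ) 1, ℝ)) - g‖) (cocompact E) atTop := by
    have h1 : Tendsto (fun e : E => ‖e‖ + -‖g‖) (cocompact E) atTop :=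
      tendsto_atTop_add_const_right _ _ tendsto_norm_cocompact_atTop
    refine tendsto_atTop_mono (fun e => ?_) h1
    have h2 := norm_sub_norm_le (e : C(Set.Icc (0 : ℝ) 1, ℝ)) g
    rw [Submodule.coe_norm]
    linarith
  obtain ⟨e, he⟩ := hcont.exists_forall_le hlim
  obtain ⟨Q, hQ, hQe⟩ := Submodule.mem_map.1 e.2
  refine ⟨Q, (hdeg Q).1 hQ, fun R hR => ?_⟩
  rw [hT, hT, hQe]
  exact he ⟨T R, Submodule.mem_map_of_mem ((hdeg R).2 hR)⟩

/-- The best uniform approximation of `f` on `[0,1]` by polynomials of degree at most `K`. -/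
def bestApprox (f : ℝ → ℝ) (K : ℕ) : Polynomial ℝ :=
  Classical.epsilon (IsBestApprox f K)

theorem isBestApprox_bestApprox {f : ℝ → ℝ} (hf : ContinuousOn f (Set.Icc 0 1)) (K : ℕ) :
    IsBestApprox f K (bestApprox f K) :=
  Classical.epsilon_spec (exists_isBestApprox hf K)

/-! ### The estimator

Here `c₁, c₂` are the tuning constants and `m` is the effective sample size: after splitting, a
symbol of probability `p` has two independent `Poi(m p)` counts. -/

/-- The threshold `Δ = c₁ ln m / m`. -/
def threshold (c₁ m : ℝ) : ℝ := c₁ * Real.log m / m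

/-- The polynomial degree `K = c₂ ln m`, rounded down to a natural number. -/
def approxDegree (c₂ m : ℝ) : ℕ := ⌊c₂ * Real.log m⌋₊

/-- The function `S_{K,α}`. -/
def lowerPoly (α c₁ c₂ m x : ℝ) : ℝ :=
  ∑ k ∈ Finset.Icc 1 (approxDegree c₂ m),
    (bestApprox (fun u => u ^ α) (approxDegree c₂ m)).coeff k *
      (4 * threshold c₁ m) ^ (-(k : ℝ) + α) * ∏ r ∈ Finset.range k, (x - (r : ℝ) / m)

/-- The function `L_α`. -/
def lowerPart (α c₁ c₂ m x : ℝ) : ℝ := min (lowerPoly α c₁ c₂ m x) 1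

/-- The smooth step `g(x; a)` on `[0,a]`. -/
def smoothStep (x a : ℝ) : ℝ :=
  126 * (x / a) ^ 5 - 420 * (x / a) ^ 6 + 540 * (x / a) ^ 7 - 315 * (x / a) ^ 8
    + 70 * (x / a) ^ 9

/-- The interpolation function between `t` and `2t`. -/
def interp (t x : ℝ) : ℝ :=
  if x ≤ t then 0 else if x < 2 * t then smoothStep (x - t) t else 1

/-- The function `U_α`. -/
def upperPart (α c₁ m x : ℝ) : ℝ :=
  interp (threshold c₁ m / 4) x * (1 + α * (1 - α) / (2 * m * x)) * x ^ α

/-- The estimator `F̂_α` as a function of the two halves `X, Y` of the split counts. -/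
def estimator (α c₁ c₂ m : ℝ) {S : ℕ} (X Y : Fin S → ℕ) : ℝ :=
  ∑ i, if (Y i : ℝ) / m ≤ 2 * threshold c₁ m then lowerPart α c₁ c₂ m ((X i : ℝ) / m)
    else upperPart α c₁ m ((X i : ℝ) / m)

/-! ### The Poissonized observation model -/

/-- The Poissonized counts with sample size `n`: independent `Z i ∼ Poi(n P i)`. -/
def poissonCounts (n : ℕ) {S : ℕ} (P : Fin S → ℝ) : Measure (Fin S → ℕ) :=
  Measure.pi fun i => poissonMeasure ((n : ℝ≥0) * (P i).toNNReal)

/-- Splitting of the counts `Z`: independent `T i ∼ B(Z i, 1/2)`, `X i = T i`,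
`Y i = Z i - T i`. -/
def splitCounts {S : ℕ} (Z : Fin S → ℕ) : Measure ((Fin S → ℕ) × (Fin S → ℕ)) :=
  (Measure.pi fun i => binomial (Z i) ⟨1 / 2, by norm_num, by norm_num⟩).map
    fun T => (T, fun i => Z i - T i)

/-- The law of the split Poissonized counts `(X, Y)`. -/
def splitPoissonCounts (n : ℕ) {S : ℕ} (P : Fin S → ℝ) :
    Measure ((Fin S → ℕ) × (Fin S → ℕ)) :=
  (poissonCounts n P).bind splitCounts

/-! ### The functional and the risk -/

/-- `F_α(P) = ∑ i, (P i) ^ α`. -/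
def powerSum (α : ℝ) {S : ℕ} (P : Fin S → ℝ) : ℝ := ∑ i, P i ^ α

/-- The squared error risk of the estimator at `P` under the Poissonized model with sample size
`n`; each half of the split counts has effective sample size `n / 2`. -/
def risk (α c₁ c₂ : ℝ) (n : ℕ) {S : ℕ} (P : Fin S → ℝ) : ℝ≥0∞ :=
  ∫⁻ z, ENNReal.ofReal ((estimator α c₁ c₂ ((n : ℝ) / 2) z.1 z.2 - powerSum α P) ^ 2)
    ∂splitPoissonCounts n P

end PowerSumEstimation

end

noncomputable section

namespace PowerSumEstimation

/-! ### Polynomials bounded on the unit interval -/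

/-! Write ρ = (m ln m)^{-(α-1)} with m = n/2. Splitting makes the pairs (X_i, Y_i) independent over
i, each a pair of independent Poi(m p_i) counts. It therefore suffices to bound, for one symbol of
probability p, the bias by C p ρ and the mean squared error by C p ρ². As ∑ p_i = 1, the errors then
add up to (C + C²) ρ², whatever S is. The factor p is essential, since S is unbounded.

Small p (at most 4Δ). Falling factorials make `lowerPoly` an unbiased estimator of (4Δ)^α (Q(x) -
Q(0)), where x = p/(4Δ) and Q is the best approximation of degree K. The bias thus needs |Q(x) -
Q(0) - x^α| ≤ D K^{-2(α-1)} x, which vanishes linearly at 0. The truncated Chebyshev series R of x^α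
has this property, because its coefficients decay like k^{-(2α+1)} while |T_k(1-2x) - 1| ≤ 4k²x. It
passes to Q by a Markov inequality for Q - R (`exists_bestApprox_sub_eval_zero_le`). The second
moment is controlled by the sum of the absolute coefficients of Q, at most 2·6^K, and by factorial
moments. The smallness of c₂ keeps the resulting 72^K below m^{7/10}.

Large p (at least Δ). `upperPart` is compared with the plug-in N^α/m^α. Its bias is of order p
(mp)^{α-2} m^{-(α-1)}, which is at most a multiple of p ρ because mp ≥ ln m and α ≤ 3/2. Its mean
squared error is of order p/m, which is at most p ρ² for large m.

When Y selects the unsuitable estimator, a Poisson tail pays for it. For p ≤ Δ, Chebyshev's bound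
1/ln m is enough for the bias. For p ≥ 4Δ, a Chernoff bound e^{-mp/8} beats the growth e^{mp/16} of
the polynomial. -/

open Polynomial in
theorem iterate_derivative_comp_affine (a b : ℝ) (P : ℝ[X]) (k : ℕ) :
    derivative^[k] (P.comp (C a + C b * X)) =
      C (b ^ k) * (derivative^[k] P).comp (C a + C b * X) := by
  induction k with
  | zero => simp
  | succ k ih =>
    rw [Function.iterate_succ_apply', ih, Function.iterate_succ_apply', derivative_C_mul,
      derivative_comp]
    simp only [derivative_add, derivative_C, derivative_C_mul, derivative_X, zero_add, mul_one,
      pow_succ, C_mul]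
    ring

open Polynomial in
theorem natDegree_comp_affine_le (a b : ℝ) (P : ℝ[X]) :
    (P.comp (C a + C b * X)).natDegree ≤ P.natDegree := by
  refine natDegree_comp_le.trans ?_
  have h : (C a + C b * X : ℝ[X]).natDegree ≤ 1 := by
    rw [add_comm]
    exact natDegree_linear_le
  nlinarith [Nat.zero_le P.natDegree]

open Polynomial Polynomial.Chebyshev in
/-- V. Markov's inequality at an endpoint of `[0,1]`. -/
theorem abs_eval_iterate_derivative_zero_le {P : ℝ[X]} {n : ℕ} {B : ℝ} (hB : 0 < B)
    (hdeg : P.natDegree ≤ n) (hP : ∀ x ∈ Set.Icc (0 : ℝ) 1, |P.eval x| ≤ B) (k : ℕ) :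
    |(derivative^[k] P).eval 0| ≤ 2 ^ k * B * (derivative^[k] (T ℝ n)).eval 1 := by
  have key : ∀ R : ℝ[X], R.natDegree ≤ n → (∀ x ∈ Set.Icc (-1 : ℝ) 1, |R.eval x| ≤ 1) →
      |(derivative^[k] R).eval 1| ≤ (derivative^[k] (T ℝ n)).eval 1 := by
    intro R hR hb
    rw [abs_le']
    refine ⟨eval_iterate_derivative_le_of_forall_abs_le_one le_rfl
      (natDegree_le_iff_degree_le.1 hR) hb, ?_⟩
    have h := eval_iterate_derivative_le_of_forall_abs_le_one (P := -R) (k := k) (x := 1) le_rfl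
      (n := n) (natDegree_le_iff_degree_le.1 ((natDegree_neg R).trans_le hR)) (by simpa using hb)
    simpa [iterate_derivative_neg] using h
  -- The map y ↦ (1 - y)/2 takes [-1,1] onto [0,1] and 1 to 0. Each derivative picks up a factor
  -- -1/2, which accounts for the 2^k.
  set R : ℝ[X] := C B⁻¹ * P.comp (C (1 / 2) + C (-1 / 2) * X) with hRdef
  have hRdeg : R.natDegree ≤ n :=
    (natDegree_C_mul_le _ _).trans ((natDegree_comp_affine_le _ _ _).trans hdeg)
  have hRb : ∀ x ∈ Set.Icc (-1 : ℝ) 1, |R.eval x| ≤ 1 := by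
    intro x hx
    have h := hP (1 / 2 + -1 / 2 * x) ⟨by linarith [hx.2], by linarith [hx.1]⟩
    simp only [hRdef, eval_mul, eval_C, eval_comp, eval_add, eval_X]
    rw [abs_mul, abs_of_pos (inv_pos.2 hB), inv_mul_le_iff₀ hB, mul_one]
    exact h
  have h := key R hRdeg hRb
  rw [hRdef, iterate_derivative_C_mul, iterate_derivative_comp_affine] at h
  simp only [eval_mul, eval_C, eval_comp, eval_add, eval_X] at h
  rw [show (1 / 2 + -1 / 2 * 1 : ℝ) = 0 by norm_num, abs_mul, abs_mul,
    abs_of_pos (inv_pos.2 hB), abs_pow, show |(-1 / 2 : ℝ)| = 1 / 2 by norm_num [abs_div]] at h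
  have h2 : (0 : ℝ) < 2 ^ k := by positivity
  calc |(derivative^[k] P).eval 0|
      = 2 ^ k * B * (B⁻¹ * ((1 / 2) ^ k * |(derivative^[k] P).eval 0|)) := by
        rw [div_pow, one_pow]
        field_simp
    _ ≤ _ := by gcongr

open Polynomial Polynomial.Chebyshev in
theorem eval_T_three_le (n : ℕ) : (T ℝ n).eval 3 ≤ 6 ^ n := by
  have h : ∀ n : ℕ, (T ℝ n).eval 3 ≤ 6 ^ n ∧ (T ℝ (n + 1 : ℕ)).eval 3 ≤ 6 ^ (n + 1) := by
    intro n
    induction n with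
    | zero => norm_num
    | succ n ih =>
      refine ⟨ih.2, ?_⟩
      have h1 := one_le_eval_T_real n (show (1 : ℝ) ≤ 3 by norm_num)
      have h2 : (T ℝ (n + 1 + 1 : ℕ)).eval 3 = 6 * (T ℝ (n + 1 : ℕ)).eval 3 - (T ℝ n).eval 3 := by
        have := T_add_two ℝ n
        push_cast
        rw [add_assoc, show (1 + 1 : ℤ) = 2 by norm_num, this]
        simp only [eval_sub, eval_mul, eval_X, eval_ofNat]
        norm_num
      rw [h2, pow_succ]
      linarith [ih.2]
  exact (h n).1

open Polynomial Polynomial.Chebyshev in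
-- Each coefficient is a Hasse derivative at 0, hence at most 2^k B times the k-th Taylor
-- coefficient of T_n at 1. Summing these against 2^k evaluates T_n at 1 + 2 = 3.
theorem sum_abs_coeff_le {P : ℝ[X]} {n : ℕ} {B : ℝ} (hB : 0 < B)
    (hdeg : P.natDegree ≤ n) (hP : ∀ x ∈ Set.Icc (0 : ℝ) 1, |P.eval x| ≤ B) :
    ∑ k ∈ Finset.range (n + 1), |P.coeff k| ≤ B * 6 ^ n := by
  have h1 : ∀ (R : ℝ[X]) (k : ℕ) (x : ℝ),
      (derivative^[k] R).eval x = (k.factorial : ℝ) * (hasseDeriv k R).eval x := by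
    intro R k x
    rw [← factorial_smul_hasseDeriv]
    simp
  have h2 : ∀ k, |P.coeff k| ≤ B * ((taylor 1 (T ℝ n)).coeff k * 2 ^ k) := by
    intro k
    have h := abs_eval_iterate_derivative_zero_le hB hdeg hP k
    rw [h1, h1, ← taylor_coeff, taylor_zero, abs_mul, Nat.abs_cast, ← taylor_coeff] at h
    have h3 : (0 : ℝ) < k.factorial := by positivity
    refine le_of_mul_le_mul_left (h.trans_eq ?_) h3
    ring
  refine (Finset.sum_le_sum fun k _ => h2 k).trans ?_
  rw [← Finset.mul_sum, ← eval_eq_sum_range' (p := taylor 1 (T ℝ n)) (n := n + 1), taylor_eval]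
  · norm_num only
    gcongr
    exact eval_T_three_le n
  · rw [natDegree_taylor, natDegree_T]
    simp

open Polynomial Polynomial.Chebyshev in
theorem abs_eval_derivative_zero_le {P : ℝ[X]} {n : ℕ} {B : ℝ} (hB : 0 < B)
    (hdeg : P.natDegree ≤ n) (hP : ∀ x ∈ Set.Icc (0 : ℝ) 1, |P.eval x| ≤ B) :
    |(derivative P).eval 0| ≤ 2 * n ^ 2 * B := by
  have h := abs_eval_iterate_derivative_zero_le hB hdeg hP 1
  simp only [Function.iterate_one, T_derivative_eq_U] at h
  rw [eval_mul, U_eval_one] at h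
  simp at h
  refine h.trans_eq ?_
  ring

open Polynomial in
-- For y ≤ 1/2, the endpoint inequality on [y,1], an interval of length at least 1/2, bounds the
-- derivative at y by 4n²B; then apply the mean value inequality. For x ≥ 1/2 the trivial bound 2B
-- is enough. This turns a uniform bound into one that vanishes linearly at 0.
theorem abs_eval_sub_eval_zero_le {P : ℝ[X]} {n : ℕ} {B : ℝ} (hB : 0 < B) (hn : 1 ≤ n)
    (hdeg : P.natDegree ≤ n) (hP : ∀ x ∈ Set.Icc (0 : ℝ) 1, |P.eval x| ≤ B)
    {x : ℝ} (hx : x ∈ Set.Icc (0 : ℝ) 1) :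
    |P.eval x - P.eval 0| ≤ 4 * n ^ 2 * B * x := by
  have hn' : (1 : ℝ) ≤ n := by exact_mod_cast hn
  rcases le_total x (1 / 2) with hx2 | hx2
  · have hder : ∀ y ∈ Set.Icc (0 : ℝ) (1 / 2), ‖(derivative P).eval y‖ ≤ 4 * n ^ 2 * B := by
      intro y hy
      have h := abs_eval_derivative_zero_le (P := P.comp (C y + C (1 - y) * X)) hB
        ((natDegree_comp_affine_le _ _ _).trans hdeg) (fun z hz => by
          simp only [eval_comp, eval_add, eval_C, eval_mul, eval_X]
          have h0 : 0 ≤ 1 - y := by linarith [hy.2]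
          refine hP _ ⟨add_nonneg hy.1 (mul_nonneg h0 hz.1), ?_⟩
          nlinarith [hz.2])
      rw [derivative_comp] at h
      simp [abs_mul] at h
      rw [abs_of_nonneg (by linarith [hy.2])] at h
      rw [Real.norm_eq_abs]
      nlinarith [hy.2, abs_nonneg ((derivative P).eval y)]
    have h := Convex.norm_image_sub_le_of_norm_hasDerivWithin_le (f := fun y => P.eval y)
      (s := Set.Icc (0 : ℝ) (1 / 2)) (x := 0) (y := x)
      (fun y _ => (P.hasDerivAt y).hasDerivWithinAt) hder (convex_Icc _ _) (by norm_num)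
      ⟨hx.1, hx2⟩
    rw [sub_zero, Real.norm_eq_abs, Real.norm_eq_abs, abs_of_nonneg hx.1] at h
    exact h
  · have h1 := hP x hx
    have h0 := hP 0 (by norm_num)
    have h2 := abs_sub (P.eval x) (P.eval 0)
    have h3 : (1 : ℝ) ≤ (n : ℝ) ^ 2 := one_le_pow₀ hn'
    have h4 : (1 : ℝ) ≤ n ^ 2 * (2 * x) := one_le_mul_of_one_le_of_one_le h3 (by linarith)
    nlinarith

/-! ### The Chebyshev expansion of a power -/

/-- The cosine coefficients of `|sin x| ^ (2 * α)`. -/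
def sinPowCoeff (α : ℝ) (k : ℕ) : ℝ :=
  ∫ x in (0 : ℝ)..Real.pi, |Real.sin x| ^ (2 * α) * Real.cos (2 * k * x)

theorem continuous_abs_sin_rpow {α : ℝ} (hα : 0 < α) :
    Continuous fun x : ℝ => |Real.sin x| ^ (2 * α) :=
  (Real.continuous_sin.abs).rpow_const fun _ => Or.inr (by positivity)

/-- Integrate the derivative of sin^{2α+1}(x) cos((2k+1)x) over [0,π]; the boundary terms vanish. -/
theorem sinPowCoeff_succ {α : ℝ} (hα : 0 < α) (k : ℕ) :
    sinPowCoeff α (k + 1) * (k + 1 + α) = sinPowCoeff α k * (k - α) := by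
  have hc := continuous_abs_sin_rpow hα
  have hder : ∀ x ∈ Set.uIcc 0 Real.pi, HasDerivAt
      (fun x => Real.sin x ^ (2 * α + 1) * Real.cos ((2 * k + 1) * x))
      ((α - k) * (|Real.sin x| ^ (2 * α) * Real.cos (2 * k * x))
        + (k + 1 + α) * (|Real.sin x| ^ (2 * α) * Real.cos (2 * (k + 1 : ℕ) * x))) x := by
    intro x hx
    rw [Set.uIcc_of_le Real.pi_pos.le] at hx
    have hs : 0 ≤ Real.sin x := Real.sin_nonneg_of_mem_Icc hx
    have h1 := (Real.hasDerivAt_sin x).rpow_const (p := 2 * α + 1) (Or.inr (by linarith))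
    have h2 : HasDerivAt (fun x => Real.cos ((2 * k + 1) * x))
        (-Real.sin ((2 * k + 1) * x) * ((2 * k + 1) * 1)) x :=
      ((hasDerivAt_id x).const_mul (2 * (k : ℝ) + 1)).cos
    refine (h1.mul h2).congr_deriv ?_
    rw [abs_of_nonneg hs, add_sub_cancel_right, Real.rpow_add_one' hs (by linarith)]
    have e1 : Real.cos (2 * k * x) = Real.cos ((2 * k + 1) * x) * Real.cos x
        + Real.sin ((2 * k + 1) * x) * Real.sin x := by
      rw [← Real.cos_sub]; ring_nf
    have e2 : Real.cos (2 * (k + 1 : ℕ) * x) = Real.cos ((2 * k + 1) * x) * Real.cos x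
        - Real.sin ((2 * k + 1) * x) * Real.sin x := by
      rw [← Real.cos_add]; push_cast; ring_nf
    rw [e1, e2]
    ring
  have hi : ∀ j : ℕ, IntervalIntegrable
      (fun x => |Real.sin x| ^ (2 * α) * Real.cos (2 * j * x)) volume 0 Real.pi := fun j =>
    (hc.mul (by fun_prop)).intervalIntegrable _ _
  have h := intervalIntegral.integral_eq_sub_of_hasDerivAt hder
    (((hi k).const_mul _).add ((hi (k + 1)).const_mul _))
  rw [intervalIntegral.integral_add ((hi k).const_mul _) ((hi (k + 1)).const_mul _),
    intervalIntegral.integral_const_mul, intervalIntegral.integral_const_mul, Real.sin_pi,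
    Real.sin_zero, Real.zero_rpow (by linarith)] at h
  simp only [sinPowCoeff]
  linarith

/-- From k = 2 on, where α ≤ 2 makes k - α nonnegative, the product of the k-th absolute coefficient
and (k+α)^{2α+1} does not increase: the ratio in the recursion is 1 - (2α+1)/(k+1+α), and
Bernoulli's inequality bounds it by (1 - 1/(k+1+α))^{2α+1}. -/
theorem exists_abs_sinPowCoeff_le {α : ℝ} (hα : 0 < α) (hα2 : α ≤ 2) :
    ∃ A : ℝ, 0 < A ∧ ∀ k : ℕ, 1 ≤ k → |sinPowCoeff α k| ≤ A * (k : ℝ) ^ (-(2 * α + 1)) := by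
  have hind : ∀ k : ℕ, 2 ≤ k → |sinPowCoeff α k| * (k + α) ^ (2 * α + 1) ≤
      |sinPowCoeff α 2| * (2 + α) ^ (2 * α + 1) := by
    intro k hk
    induction k, hk using Nat.le_induction with
    | base => norm_num
    | succ k hk ih =>
      refine le_trans ?_ ih
      have hk' : (2 : ℝ) ≤ k := by exact_mod_cast hk
      have hx : 0 < (k : ℝ) + 1 + α := by linarith
      have hx' : 0 < (k : ℝ) + α := by linarith
      have h1 : sinPowCoeff α (k + 1) = sinPowCoeff α k * ((k - α) / (k + 1 + α)) := by
        rw [← mul_div_assoc, ← sinPowCoeff_succ hα k, mul_div_cancel_right₀ _ hx.ne']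
      have h2 : (k - α) / (k + 1 + α) ≤ ((k + α) / (k + 1 + α)) ^ (2 * α + 1) := by
        have := one_add_mul_self_le_rpow_one_add (s := -1 / (k + 1 + α))
          (by rw [le_div_iff₀ hx]; linarith) (p := 2 * α + 1) (by linarith)
        convert! this using 1
        · field_simp; ring
        · congr 1; field_simp; ring
      have h3 : 0 ≤ (k - α) / (k + 1 + α) := div_nonneg (by linarith) hx.le
      push_cast
      rw [h1, abs_mul, abs_of_nonneg h3, mul_assoc]
      gcongr
      rw [Real.div_rpow hx'.le hx.le, le_div_iff₀ (by positivity)] at h2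
      exact h2
  refine ⟨max 1 (max |sinPowCoeff α 1| (|sinPowCoeff α 2| * (2 + α) ^ (2 * α + 1))),
    lt_max_of_lt_left one_pos, fun k hk => ?_⟩
  have hk0 : (0 : ℝ) < k := by exact_mod_cast hk
  rw [Real.rpow_neg hk0.le, ← div_eq_mul_inv, le_div_iff₀ (by positivity)]
  rcases hk.eq_or_lt with rfl | hk2
  · simp
  · refine le_trans ?_ ((hind k hk2).trans ((le_max_right _ _).trans (le_max_right _ _)))
    gcongr
    linarith

theorem integral_abs_sin_rpow_mul_sin (α : ℝ) (k : ℕ) :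
    ∫ x in (0 : ℝ)..Real.pi, |Real.sin x| ^ (2 * α) * Real.sin (2 * k * x) = 0 := by
  have h := intervalIntegral.integral_comp_sub_left (a := 0) (b := Real.pi)
    (fun x => |Real.sin x| ^ (2 * α) * Real.sin (2 * k * x)) Real.pi
  rw [sub_self, sub_zero] at h
  have h2 : ∀ x : ℝ, |Real.sin (Real.pi - x)| ^ (2 * α) * Real.sin (2 * k * (Real.pi - x)) =
      -(|Real.sin x| ^ (2 * α) * Real.sin (2 * k * x)) := by
    intro x
    rw [Real.sin_pi_sub, show 2 * k * (Real.pi - x) = k * (2 * Real.pi) - 2 * k * x by ring,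
      Real.sin_nat_mul_two_pi_sub]
    ring
  simp only [h2, intervalIntegral.integral_neg] at h
  linarith

/-- `|sin x| ^ (2 * α)` as a function on the circle of length `π`. -/
def sinPowCircle (α : ℝ) (hα : 0 < α) : C(AddCircle Real.pi, ℂ) where
  toFun := Function.Periodic.lift (f := fun x : ℝ => ((|Real.sin x| ^ (2 * α) : ℝ) : ℂ))
    (c := Real.pi) fun x => by simp [Real.sin_add_pi]
  continuous_toFun := continuous_coinduced_dom.2
    (Complex.continuous_ofReal.comp (continuous_abs_sin_rpow hα))

theorem fourierCoeff_sinPowCircle (α : ℝ) (hα : 0 < α) [Fact (0 < Real.pi)] (n : ℤ) :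
    fourierCoeff (sinPowCircle α hα) n =
      ((Real.pi⁻¹ * sinPowCoeff α n.natAbs : ℝ) : ℂ) := by
  rw [fourierCoeff_eq_intervalIntegral _ n 0, zero_add]
  have hc := continuous_abs_sin_rpow hα
  have h1 : ∀ x : ℝ, (fourier (-n) (x : AddCircle Real.pi)) • sinPowCircle α hα x =
      ((|Real.sin x| ^ (2 * α) * Real.cos (2 * n * x) : ℝ) : ℂ)
        + ((-(|Real.sin x| ^ (2 * α) * Real.sin (2 * n * x)) : ℝ) : ℂ) * Complex.I := by
    intro x
    rw [fourier_coe_apply]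
    have : (2 * Real.pi * Complex.I * (-n : ℤ) * x / Real.pi : ℂ) =
        ((-(2 * n * x) : ℝ) : ℂ) * Complex.I := by
      have := Real.pi_ne_zero
      push_cast
      field_simp
    rw [this, Complex.exp_mul_I, ← Complex.ofReal_cos, ← Complex.ofReal_sin, Real.cos_neg,
      Real.sin_neg]
    change _ * ((|Real.sin x| ^ (2 * α) : ℝ) : ℂ) = _
    push_cast
    ring
  have i1 : IntervalIntegrable (fun x : ℝ =>
      ((|Real.sin x| ^ (2 * α) * Real.cos (2 * n * x) : ℝ) : ℂ)) volume 0 Real.pi :=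
    (Complex.continuous_ofReal.comp (hc.mul (by fun_prop))).intervalIntegrable _ _
  have i2 : IntervalIntegrable (fun x : ℝ =>
      ((-(|Real.sin x| ^ (2 * α) * Real.sin (2 * n * x)) : ℝ) : ℂ) * Complex.I)
      volume 0 Real.pi :=
    ((Complex.continuous_ofReal.comp (hc.mul (by fun_prop)).neg).mul_const _).intervalIntegrable
      _ _
  simp only [h1]
  rw [intervalIntegral.integral_add i1 i2, intervalIntegral.integral_mul_const,
    intervalIntegral.integral_ofReal, intervalIntegral.integral_ofReal,
    intervalIntegral.integral_neg]
  have e1 : ∫ x in (0 : ℝ)..Real.pi, |Real.sin x| ^ (2 * α) * Real.cos (2 * n * x) =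
      sinPowCoeff α n.natAbs := by
    rcases Int.natAbs_eq n with h | h
    · rw [sinPowCoeff]; conv_lhs => rw [h]
      simp
    · rw [sinPowCoeff]; conv_lhs => rw [h]
      simp
  have e2 : ∫ x in (0 : ℝ)..Real.pi, |Real.sin x| ^ (2 * α) * Real.sin (2 * n * x) = 0 := by
    rcases Int.natAbs_eq n with h | h
    · rw [h]
      exact_mod_cast integral_abs_sin_rpow_mul_sin α n.natAbs
    · rw [h]
      have := integral_abs_sin_rpow_mul_sin α n.natAbs
      simpa using this
  rw [e1, e2]
  simp

/-- The decay of the coefficients makes the Fourier series absolutely summable, hence pointwise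
convergent. Pairing n with -n over all n ≥ 0 counts frequency 0 twice, which produces the extra
constant on the right. -/
theorem hasSum_cos_sinPowCoeff {α : ℝ} (hα : 0 < α) (hα2 : α ≤ 2) (x : ℝ) :
    HasSum (fun k : ℕ => 2 * Real.pi⁻¹ * sinPowCoeff α k * Real.cos (k * (2 * x)))
      (|Real.sin x| ^ (2 * α) + Real.pi⁻¹ * sinPowCoeff α 0) := by
  have : Fact (0 < Real.pi) := ⟨Real.pi_pos⟩
  obtain ⟨A, -, hA⟩ := exists_abs_sinPowCoeff_le hα hα2
  have hs : Summable fun k : ℕ => ((Real.pi⁻¹ * sinPowCoeff α k : ℝ) : ℂ) := by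
    rw [Complex.summable_ofReal]
    refine Summable.mul_left _ ?_
    have h : Summable fun k : ℕ => A * (k : ℝ) ^ (-(2 * α + 1)) :=
      (Real.summable_nat_rpow.2 (by linarith)).mul_left _
    refine Summable.of_norm_bounded_eventually_nat h ?_
    filter_upwards [eventually_ge_atTop 1] with k hk using hA k hk
  have hsum : Summable (fourierCoeff (sinPowCircle α hα)) := by
    refine Summable.of_nat_of_neg ?_ ?_
    · simpa only [fourierCoeff_sinPowCircle, Int.natAbs_natCast] using hs
    · simpa only [fourierCoeff_sinPowCircle, Int.natAbs_natCast, Int.natAbs_neg] using hs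
  have h := (has_pointwise_sum_fourier_series_of_summable hsum x).nat_add_neg
  have h3 : ∀ n : ℤ, (fourier n (x : AddCircle Real.pi)) =
      Complex.exp (((n * (2 * x) : ℝ) : ℂ) * Complex.I) := by
    intro n
    rw [fourier_coe_apply]
    congr 1
    have := Real.pi_ne_zero
    push_cast
    field_simp
  simp only [fourierCoeff_sinPowCircle, Int.natAbs_natCast, Int.natAbs_neg, h3] at h
  have h4 := Complex.hasSum_re h
  convert! h4 using 1
  · ext k
    simp only [smul_eq_mul, Complex.add_re, Complex.re_ofReal_mul, Complex.exp_ofReal_mul_I_re]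
    push_cast
    rw [neg_mul, Real.cos_neg]
    ring
  · simp only [smul_eq_mul, Complex.add_re, Complex.re_ofReal_mul, Complex.exp_ofReal_mul_I_re]
    change _ = ((|Real.sin x| ^ (2 * α) : ℝ) : ℂ).re + _
    simp

open Polynomial in
-- Substitute x = sin²θ: then |sin θ|^{2α} = x^α and cos 2kθ = T_k(cos 2θ) = T_k(1 - 2x).
theorem exists_hasSum_T_rpow {α : ℝ} (hα : 0 < α) (hα2 : α ≤ 2) :
    ∃ (b : ℕ → ℝ) (A c : ℝ), 0 < A ∧ (∀ k : ℕ, 1 ≤ k → |b k| ≤ A * (k : ℝ) ^ (-(2 * α + 1))) ∧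
      ∀ x ∈ Set.Icc (0 : ℝ) 1,
        HasSum (fun k : ℕ => b k * (Chebyshev.T ℝ k).eval (1 - 2 * x)) (x ^ α + c) := by
  obtain ⟨A, hA0, hA⟩ := exists_abs_sinPowCoeff_le hα hα2
  refine ⟨fun k => 2 * Real.pi⁻¹ * sinPowCoeff α k, 2 * Real.pi⁻¹ * A,
    Real.pi⁻¹ * sinPowCoeff α 0, by positivity, fun k hk => ?_, fun x hx => ?_⟩
  · rw [abs_mul, abs_of_pos (by positivity : (0 : ℝ) < 2 * Real.pi⁻¹), mul_assoc _ A]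
    gcongr
    exact hA k hk
  · have h := hasSum_cos_sinPowCoeff hα hα2 (Real.arcsin (Real.sqrt x))
    have hs : Real.sin (Real.arcsin (Real.sqrt x)) = Real.sqrt x :=
      Real.sin_arcsin (by linarith [Real.sqrt_nonneg x]) (Real.sqrt_le_one.2 hx.2)
    have hc : Real.cos (2 * Real.arcsin (Real.sqrt x)) = 1 - 2 * x := by
      rw [Real.cos_two_mul', Real.cos_sq', hs, Real.sq_sqrt hx.1]
      ring
    rw [hs, abs_of_nonneg (Real.sqrt_nonneg x), Real.rpow_mul (Real.sqrt_nonneg x), Real.rpow_two,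
      Real.sq_sqrt hx.1] at h
    convert! h using 2 with k
    rw [← hc]
    congr 1
    exact Chebyshev.T_real_cos _ k

/-! ### Best approximation of a power -/

/-- The right side is the integral of t^{-s} over [x-1, x]. This form telescopes when summed. -/
theorem rpow_neg_le_sub {s x : ℝ} (hs : 1 < s) (hx : 1 < x) :
    x ^ (-s) ≤ ((x - 1) ^ (1 - s) - x ^ (1 - s)) / (s - 1) := by
  have hx0 : 0 < x := by linarith
  have hx1 : 0 < x - 1 := by linarith
  have h1 : 1 + (s - 1) / x ≤ ((x - 1) / x) ^ (1 - s) := by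
    have hy : 0 < (x - 1) / x := by positivity
    have hl := Real.log_le_sub_one_of_pos hy
    have h2 : (x - 1) / x - 1 = -1 / x := by field_simp; ring
    rw [Real.rpow_def_of_pos hy]
    have h3 : (s - 1) / x ≤ Real.log ((x - 1) / x) * (1 - s) := by
      rw [h2] at hl
      have := mul_le_mul_of_nonneg_left hl (by linarith : 0 ≤ s - 1)
      have e : (s - 1) * (-1 / x) = -((s - 1) / x) := by ring
      linarith
    linarith [Real.add_one_le_exp (Real.log ((x - 1) / x) * (1 - s))]
  rw [Real.div_rpow hx1.le hx0.le, le_div_iff₀ (by positivity)] at h1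
  rw [le_div_iff₀ (by linarith)]
  have h3 : x ^ (1 - s) = x * x ^ (-s) := by
    rw [sub_eq_add_neg, Real.rpow_add hx0, Real.rpow_one]
  have h4 : (1 + (s - 1) / x) * x ^ (1 - s) = x ^ (1 - s) + x ^ (-s) * (s - 1) := by
    rw [h3]; field_simp
  linarith

theorem summable_tail_rpow_neg {s : ℝ} (hs : 1 < s) (K : ℕ) :
    Summable fun j : ℕ => ((j + (K + 1) : ℕ) : ℝ) ^ (-s) :=
  (summable_nat_add_iff (f := fun k : ℕ => (k : ℝ) ^ (-s)) (K + 1)).2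
    (Real.summable_nat_rpow.2 (by linarith))

theorem tsum_tail_rpow_neg_le {s : ℝ} (hs : 1 < s) {K : ℕ} (hK : 1 ≤ K) :
    ∑' j : ℕ, ((j + (K + 1) : ℕ) : ℝ) ^ (-s) ≤ (K : ℝ) ^ (1 - s) / (s - 1) := by
  have hK' : (1 : ℝ) ≤ K := by exact_mod_cast hK
  refine Real.tsum_le_of_sum_range_le (fun j => by positivity) fun N => ?_
  have h : ∀ j ∈ Finset.range N, ((j + (K + 1) : ℕ) : ℝ) ^ (-s) ≤
      -(((j + 1 : ℕ) + K : ℝ) ^ (1 - s) / (s - 1)) - -((((j : ℕ) + K : ℝ) ^ (1 - s)) / (s - 1)) := by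
    intro j _
    have := rpow_neg_le_sub hs (x := ((j + (K + 1) : ℕ) : ℝ))
      (by push_cast; nlinarith [j.cast_nonneg (α := ℝ)])
    refine this.trans_eq ?_
    push_cast
    rw [show (j : ℝ) + (K + 1) - 1 = j + K by ring, show (j : ℝ) + (K + 1) = j + 1 + K by ring]
    ring
  refine (Finset.sum_le_sum h).trans ?_
  rw [Finset.sum_range_sub (fun j : ℕ => -(((j : ℝ) + K) ^ (1 - s) / (s - 1)))]
  have : 0 ≤ ((N : ℝ) + K) ^ (1 - s) / (s - 1) :=
    div_nonneg (by positivity) (by linarith)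
  simp only [Nat.cast_zero, zero_add]
  linarith

open Polynomial in
theorem abs_eval_T_one_sub_two_mul_le (k : ℕ) {x : ℝ} (hx : x ∈ Set.Icc (0 : ℝ) 1) :
    |(Chebyshev.T ℝ k).eval (1 - 2 * x)| ≤ 1 :=
  Chebyshev.abs_eval_T_real_le_one k (abs_le.2 ⟨by linarith [hx.2], by linarith [hx.1]⟩)

open Polynomial in
theorem natDegree_T_comp_le (k : ℕ) :
    ((Chebyshev.T ℝ k).comp (C 1 + C (-2) * X)).natDegree ≤ k :=
  (natDegree_comp_affine_le _ _ _).trans (by simp [Chebyshev.natDegree_T])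

open Polynomial in
theorem abs_eval_T_sub_one_le {k : ℕ} (hk : 1 ≤ k) {x : ℝ} (hx : x ∈ Set.Icc (0 : ℝ) 1) :
    |(Chebyshev.T ℝ k).eval (1 - 2 * x) - 1| ≤ 4 * k ^ 2 * x := by
  have h := abs_eval_sub_eval_zero_le (P := (Chebyshev.T ℝ k).comp (C 1 + C (-2) * X))
    one_pos hk (natDegree_T_comp_le k) (fun y hy => by
      have := abs_eval_T_one_sub_two_mul_le k hy
      simpa [sub_eq_add_neg] using this) hx
  simpa [sub_eq_add_neg] using h

open Polynomial in
/-- A near-best approximation of `x ^ α` which is also accurate at the endpoint `0`. -/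
theorem exists_poly_approx_rpow {α : ℝ} (hα : 1 < α) (hα2 : α ≤ 2) :
    ∃ D : ℝ, 0 < D ∧ ∀ K : ℕ, 1 ≤ K → ∃ R : ℝ[X], R.natDegree ≤ K ∧
      ∀ x ∈ Set.Icc (0 : ℝ) 1, |R.eval x - x ^ α| ≤ D * (K : ℝ) ^ (-(2 * α)) ∧
        |R.eval x - R.eval 0 - x ^ α| ≤ D * (K : ℝ) ^ (-(2 * (α - 1))) * x := by
  obtain ⟨b, A, c, hA, hb, hsum⟩ := exists_hasSum_T_rpow (by linarith : 0 < α) hα2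
  refine ⟨A / (2 * α) + 4 * A / (2 * (α - 1)), ?_, fun K hK => ?_⟩
  · have : 0 < α - 1 := by linarith
    positivity
  have hK0 : (0 : ℝ) < K := by exact_mod_cast hK
  have hα1 : 0 < α - 1 := by linarith
  set R : ℝ[X] := ∑ k ∈ Finset.range (K + 1),
    C (b k) * (Chebyshev.T ℝ k).comp (C 1 + C (-2) * X) - C c with hR
  have hev : ∀ x, R.eval x =
      ∑ k ∈ Finset.range (K + 1), b k * (Chebyshev.T ℝ k).eval (1 - 2 * x) - c := by
    intro x
    simp [hR, eval_finsetSum, sub_eq_add_neg]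
  have htail : ∀ x ∈ Set.Icc (0 : ℝ) 1, HasSum (fun j : ℕ => b (j + (K + 1)) *
      (Chebyshev.T ℝ (j + (K + 1) : ℕ)).eval (1 - 2 * x)) (x ^ α - R.eval x) := by
    intro x hx
    have h := (hasSum_nat_add_iff' (K + 1)).2 (hsum x hx)
    rw [hev]
    convert! h using 1
    ring
  have hbj : ∀ j : ℕ, |b (j + (K + 1))| ≤ A * ((j + (K + 1) : ℕ) : ℝ) ^ (-(2 * α + 1)) :=
    fun j => hb _ (by omega)
  refine ⟨R, ?_, fun x hx => ⟨?_, ?_⟩⟩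
  · refine natDegree_sub_C.le.trans (natDegree_sum_le_of_forall_le _ _ fun k hk => ?_)
    rw [Finset.mem_range] at hk
    exact ((natDegree_C_mul_le _ _).trans (natDegree_T_comp_le k)).trans (by omega)
  · have h1 : ‖x ^ α - R.eval x‖ ≤ A * ((K : ℝ) ^ (1 - (2 * α + 1)) / (2 * α + 1 - 1)) := by
      rw [← (htail x hx).tsum_eq]
      have hs := summable_tail_rpow_neg (s := 2 * α + 1) (by linarith) K
      refine (tsum_of_norm_bounded (hs.mul_left A).hasSum fun j => ?_).trans ?_
      · rw [norm_mul, Real.norm_eq_abs, Real.norm_eq_abs]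
        exact (mul_le_of_le_one_right (abs_nonneg _)
          (abs_eval_T_one_sub_two_mul_le _ hx)).trans (hbj j)
      · rw [tsum_mul_left]
        gcongr
        exact tsum_tail_rpow_neg_le (by linarith) hK
    rw [Real.norm_eq_abs, abs_sub_comm, show 1 - (2 * α + 1) = -(2 * α) by ring,
      show 2 * α + 1 - 1 = 2 * α by ring] at h1
    refine h1.trans ?_
    rw [add_mul, ← mul_div_assoc, mul_div_right_comm]
    have : 0 ≤ 4 * A / (2 * (α - 1)) * (K : ℝ) ^ (-(2 * α)) := by positivity
    linarith
  · have h0 := htail 0 (by norm_num)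
    have hd := (htail x hx).sub h0
    rw [Real.zero_rpow (by linarith)] at hd
    -- Subtracting the value at 0 replaces T_k by T_k - 1, which costs 4k²x. The tail exponent drops
    -- from 2α+1 to 2α-1, still greater than 1 because α > 1.
    have h1 : ‖x ^ α - R.eval x - (0 - R.eval 0)‖ ≤
        4 * A * x * ((K : ℝ) ^ (1 - (2 * α - 1)) / (2 * α - 1 - 1)) := by
      rw [← hd.tsum_eq]
      have hs := summable_tail_rpow_neg (s := 2 * α - 1) (by linarith) K
      refine (tsum_of_norm_bounded (hs.mul_left (4 * A * x)).hasSum fun j => ?_).trans ?_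
      · rw [← mul_sub, norm_mul, Real.norm_eq_abs, Real.norm_eq_abs]
        have hT := abs_eval_T_sub_one_le (k := j + (K + 1)) (by omega) hx
        have hk0 : (0 : ℝ) < (j + (K + 1) : ℕ) := by positivity
        have e : ((j + (K + 1) : ℕ) : ℝ) ^ (-(2 * α - 1)) =
            ((j + (K + 1) : ℕ) : ℝ) ^ (-(2 * α + 1)) * ((j + (K + 1) : ℕ) : ℝ) ^ 2 := by
          rw [← Real.rpow_natCast, ← Real.rpow_add hk0]
          congr 1
          push_cast
          ring
        rw [mul_zero, sub_zero, Chebyshev.T_eval_one, e]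
        calc _ ≤ (A * ((j + (K + 1) : ℕ) : ℝ) ^ (-(2 * α + 1))) *
              (4 * ((j + (K + 1) : ℕ) : ℝ) ^ 2 * x) :=
              mul_le_mul (hbj j) hT (abs_nonneg _) (by positivity)
          _ = _ := by ring
      · rw [tsum_mul_left]
        have := hx.1
        gcongr
        exact tsum_tail_rpow_neg_le (by linarith) hK
    rw [Real.norm_eq_abs, abs_sub_comm, show 1 - (2 * α - 1) = -(2 * (α - 1)) by ring,
      show 2 * α - 1 - 1 = 2 * (α - 1) by ring,
      show 0 - R.eval 0 - (x ^ α - R.eval x) = R.eval x - R.eval 0 - x ^ α by ring] at h1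
    refine h1.trans ?_
    have := hx.1
    have h2 : 0 ≤ A / (2 * α) * (K : ℝ) ^ (-(2 * (α - 1))) * x := by positivity
    calc _ = 4 * A / (2 * (α - 1)) * (K : ℝ) ^ (-(2 * (α - 1))) * x := by ring
      _ ≤ _ := by rw [add_mul, add_mul]; linarith

open Polynomial in
theorem abs_eval_sub_le_unifDist {f : ℝ → ℝ} (hf : ContinuousOn f (Set.Icc 0 1)) (Q : ℝ[X])
    {x : ℝ} (hx : x ∈ Set.Icc (0 : ℝ) 1) : |Q.eval x - f x| ≤ unifDist f Q := by
  refine le_ciSup (f := fun x : Set.Icc (0 : ℝ) 1 => |Q.eval (x : ℝ) - f x|) ?_ ⟨x, hx⟩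
  have h := (isCompact_Icc (a := (0 : ℝ)) (b := 1)).bddAbove_image
    (Q.continuous.continuousOn.sub hf).abs
  refine h.mono ?_
  rintro _ ⟨y, rfl⟩
  exact ⟨y, y.2, rfl⟩

open Polynomial in
theorem unifDist_le {f : ℝ → ℝ} {Q : ℝ[X]} {B : ℝ}
    (h : ∀ x ∈ Set.Icc (0 : ℝ) 1, |Q.eval x - f x| ≤ B) : unifDist f Q ≤ B :=
  have : Nonempty (Set.Icc (0 : ℝ) 1) := ⟨⟨0, by norm_num⟩⟩
  ciSup_le fun x => h x x.2

theorem isBestApprox_rpow {α : ℝ} (hα : 0 < α) (K : ℕ) :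
    IsBestApprox (fun u => u ^ α) K (bestApprox (fun u => u ^ α) K) :=
  isBestApprox_bestApprox
    (fun _ _ => (Real.continuousAt_rpow_const _ _ (Or.inr hα.le)).continuousWithinAt) K

open Polynomial in
theorem abs_bestApprox_sub_le {α : ℝ} (hα : 0 < α) {K : ℕ} {R : ℝ[X]} {B : ℝ}
    (hR : R.natDegree ≤ K) (h : ∀ x ∈ Set.Icc (0 : ℝ) 1, |R.eval x - x ^ α| ≤ B)
    {x : ℝ} (hx : x ∈ Set.Icc (0 : ℝ) 1) :
    |(bestApprox (fun u => u ^ α) K).eval x - x ^ α| ≤ B :=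
  (abs_eval_sub_le_unifDist
    (fun _ _ => (Real.continuousAt_rpow_const _ _ (Or.inr hα.le)).continuousWithinAt) _ hx).trans
    (((isBestApprox_rpow hα K).2 R hR).trans (unifDist_le h))

/-- Competing with the zero polynomial shows that the best error is at most 1, so the best
approximation is bounded by 2 on [0,1]. -/
theorem sum_abs_coeff_bestApprox_le {α : ℝ} (hα : 0 < α) (K : ℕ) :
    ∑ k ∈ Finset.range (K + 1), |(bestApprox (fun u => u ^ α) K).coeff k| ≤ 2 * 6 ^ K := by
  refine sum_abs_coeff_le two_pos (isBestApprox_rpow hα K).1 fun x hx => ?_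
  have h1 : ∀ y ∈ Set.Icc (0 : ℝ) 1, |y ^ α| ≤ 1 := fun y hy => by
    rw [abs_of_nonneg (Real.rpow_nonneg hy.1 _)]
    exact Real.rpow_le_one hy.1 hy.2 hα.le
  have h2 := abs_bestApprox_sub_le hα (K := K) (R := 0) (B := 1) (by simp)
    (fun y hy => by simpa using h1 y hy) hx
  have h3 := abs_add_le ((bestApprox (fun u => u ^ α) K).eval x - x ^ α) (x ^ α)
  rw [sub_add_cancel] at h3
  linarith [h1 x hx]

/-- Optimality controls the best approximation Q only uniformly, not near 0. However, Q - R is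
uniformly at most 2DK^{-2α} for the truncated Chebyshev series R, and the Markov bound makes its
increment from 0 at most 8DK^{2-2α}x. With the error D of R itself this gives 9D. -/
theorem exists_bestApprox_sub_eval_zero_le {α : ℝ} (hα : 1 < α) (hα2 : α ≤ 2) :
    ∃ D : ℝ, 0 < D ∧ ∀ K : ℕ, 1 ≤ K → ∀ x ∈ Set.Icc (0 : ℝ) 1,
      |(bestApprox (fun u => u ^ α) K).eval x - (bestApprox (fun u => u ^ α) K).eval 0 - x ^ α| ≤
        D * (K : ℝ) ^ (-(2 * (α - 1))) * x := by
  obtain ⟨D, hD, h⟩ := exists_poly_approx_rpow hα hα2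
  refine ⟨9 * D, by positivity, fun K hK x hx => ?_⟩
  obtain ⟨R, hR, hRx⟩ := h K hK
  set Q := bestApprox (fun u => u ^ α) K with hQ
  have hα0 : 0 < α := by linarith
  have hK0 : (0 : ℝ) < K := by exact_mod_cast hK
  have hQx : ∀ y ∈ Set.Icc (0 : ℝ) 1, |Q.eval y - y ^ α| ≤ D * (K : ℝ) ^ (-(2 * α)) := fun y hy =>
    abs_bestApprox_sub_le hα0 hR (fun z hz => (hRx z hz).1) hy
  have h1 := abs_eval_sub_eval_zero_le (P := Q - R) (B := 2 * (D * (K : ℝ) ^ (-(2 * α))))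
    (by positivity) hK ((Polynomial.natDegree_sub_le _ _).trans
      (max_le (isBestApprox_rpow hα0 K).1 hR)) (fun y hy => by
      rw [Polynomial.eval_sub, ← sub_sub_sub_cancel_right _ _ (y ^ α)]
      exact (abs_sub _ _).trans (by linarith [hQx y hy, (hRx y hy).1])) hx
  have h2 := (hRx x hx).2
  have e : (K : ℝ) ^ (-(2 * (α - 1))) = (K : ℝ) ^ (-(2 * α)) * (K : ℝ) ^ 2 := by
    rw [← Real.rpow_natCast, ← Real.rpow_add hK0]
    congr 1
    push_cast
    ring
  have h3 := abs_add_le ((Q - R).eval x - (Q - R).eval 0) (R.eval x - R.eval 0 - x ^ α)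
  rw [show (Q - R).eval x - (Q - R).eval 0 + (R.eval x - R.eval 0 - x ^ α) =
    Q.eval x - Q.eval 0 - x ^ α by simp only [Polynomial.eval_sub]; ring] at h3
  rw [e] at h2 ⊢
  linarith

/-! ### Moments and tails of the Poisson distribution -/

/-- `f` is bounded by a polynomial. -/
def PolyGrowth (f : ℕ → ℝ) : Prop := ∃ (C : ℝ) (k : ℕ), ∀ n, |f n| ≤ C * ((n : ℝ) + 1) ^ k

theorem PolyGrowth.mono {f g : ℕ → ℝ} (hg : PolyGrowth g) (h : ∀ n, |f n| ≤ |g n|) :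
    PolyGrowth f := by
  obtain ⟨C, k, hC⟩ := hg
  exact ⟨C, k, fun n => (h n).trans (hC n)⟩

theorem PolyGrowth.const (c : ℝ) : PolyGrowth fun _ => c := ⟨|c|, 0, fun n => by simp⟩

theorem PolyGrowth.natCast : PolyGrowth fun n => (n : ℝ) :=
  ⟨1, 1, fun n => by rw [Nat.abs_cast]; linarith⟩

theorem PolyGrowth.add {f g : ℕ → ℝ} (hf : PolyGrowth f) (hg : PolyGrowth g) :
    PolyGrowth fun n => f n + g n := by
  obtain ⟨C, k, hC⟩ := hf
  obtain ⟨D, l, hD⟩ := hg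
  have hC0 : 0 ≤ C := by have := (abs_nonneg _).trans (hC 0); simpa using this
  have hD0 : 0 ≤ D := by have := (abs_nonneg _).trans (hD 0); simpa using this
  refine ⟨C + D, k + l, fun n => (abs_add_le _ _).trans ?_⟩
  have h1 : (1 : ℝ) ≤ (n : ℝ) + 1 := by linarith [n.cast_nonneg (α := ℝ)]
  rw [add_mul]
  refine add_le_add ((hC n).trans ?_) ((hD n).trans ?_)
  · gcongr
    exact Nat.le_add_right _ _
  · gcongr
    exact Nat.le_add_left _ _

theorem PolyGrowth.mul {f g : ℕ → ℝ} (hf : PolyGrowth f) (hg : PolyGrowth g) :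
    PolyGrowth fun n => f n * g n := by
  obtain ⟨C, k, hC⟩ := hf
  obtain ⟨D, l, hD⟩ := hg
  refine ⟨C * D, k + l, fun n => ?_⟩
  rw [abs_mul, pow_add]
  calc _ ≤ (C * ((n : ℝ) + 1) ^ k) * (D * ((n : ℝ) + 1) ^ l) :=
        mul_le_mul (hC n) (hD n) (abs_nonneg _) ((abs_nonneg _).trans (hC n))
    _ = _ := by ring

theorem PolyGrowth.sub {f g : ℕ → ℝ} (hf : PolyGrowth f) (hg : PolyGrowth g) :
    PolyGrowth fun n => f n - g n := by
  have := hf.add ((PolyGrowth.const (-1)).mul hg)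
  simpa [sub_eq_add_neg] using this

theorem PolyGrowth.pow {f : ℕ → ℝ} (hf : PolyGrowth f) (k : ℕ) : PolyGrowth fun n => f n ^ k := by
  induction k with
  | zero => simpa using PolyGrowth.const 1
  | succ k ih => simpa [pow_succ] using ih.mul hf

theorem PolyGrowth.sum {ι : Type*} (s : Finset ι) {f : ι → ℕ → ℝ} (h : ∀ i ∈ s, PolyGrowth (f i)) :
    PolyGrowth fun n => ∑ i ∈ s, f i n := by
  classical
  induction s using Finset.induction_on with
  | empty => simpa using PolyGrowth.const 0
  | insert a s ha ih =>
    simp only [Finset.sum_insert ha]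
    exact (h a (Finset.mem_insert_self _ _)).add
      (ih fun i hi => h i (Finset.mem_insert_of_mem hi))

theorem PolyGrowth.prod {ι : Type*} (s : Finset ι) {f : ι → ℕ → ℝ} (h : ∀ i ∈ s, PolyGrowth (f i)) :
    PolyGrowth fun n => ∏ i ∈ s, f i n := by
  classical
  induction s using Finset.induction_on with
  | empty => simpa using PolyGrowth.const 1
  | insert a s ha ih =>
    simp only [Finset.prod_insert ha]
    exact (h a (Finset.mem_insert_self _ _)).mul
      (ih fun i hi => h i (Finset.mem_insert_of_mem hi))

theorem PolyGrowth.comp_add {f : ℕ → ℝ} (hf : PolyGrowth f) (j : ℕ) :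
    PolyGrowth fun n => f (n + j) := by
  obtain ⟨C, k, hC⟩ := hf
  have hC0 : 0 ≤ C := by have := (abs_nonneg _).trans (hC 0); simpa using this
  have h := ((PolyGrowth.natCast.add (PolyGrowth.const ((j : ℝ) + 1))).pow k)
  refine ((PolyGrowth.const C).mul h).mono fun n => (hC _).trans ?_
  push_cast
  rw [abs_of_nonneg (by positivity), add_assoc]

theorem PolyGrowth.rpow {a : ℝ} (ha : 0 ≤ a) : PolyGrowth fun n => (n : ℝ) ^ a := by
  refine ⟨1, ⌈a⌉₊, fun n => ?_⟩
  have h0 : (0 : ℝ) ≤ n := n.cast_nonneg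
  rw [abs_of_nonneg (Real.rpow_nonneg h0 _), one_mul, ← Real.rpow_natCast]
  exact (Real.rpow_le_rpow h0 (by linarith) ha).trans
    (Real.rpow_le_rpow_of_exponent_le (by linarith) (Nat.le_ceil a))

theorem PolyGrowth.descFactorial (k : ℕ) : PolyGrowth fun n => (n.descFactorial k : ℝ) :=
  (PolyGrowth.natCast.pow k).mono fun n => by
    rw [Nat.abs_cast, abs_of_nonneg (by positivity)]
    exact_mod_cast Nat.descFactorial_le_pow n k

/-- (n+1)^k is at most k! e^{n+1}, and the Poisson series with r replaced by er still converges. -/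
theorem PolyGrowth.integrable {f : ℕ → ℝ} (hf : PolyGrowth f) (r : ℝ≥0) :
    Integrable f (poissonMeasure r) := by
  obtain ⟨C, k, hC⟩ := hf
  rw [integrable_poissonMeasure_iff]
  have hs := (Real.summable_pow_div_factorial ((r : ℝ) * Real.exp 1)).mul_left
    (Real.exp (-r) * (C * (k.factorial * Real.exp 1)))
  refine Summable.of_nonneg_of_le (fun n => by positivity) (fun n => ?_) hs
  have h1 := Real.pow_div_factorial_le_exp ((n : ℝ) + 1) (by positivity) k
  rw [div_le_iff₀ (by positivity)] at h1
  have hC0 : 0 ≤ C := by have := (abs_nonneg _).trans (hC 0); simpa using this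
  have h2 : |f n| ≤ C * (k.factorial * Real.exp 1) * Real.exp 1 ^ n := by
    refine (hC n).trans ?_
    rw [← Real.exp_nat_mul, mul_one, mul_assoc, mul_assoc, ← Real.exp_add]
    gcongr
    rw [mul_comm, add_comm 1]
    exact h1
  rw [Real.norm_eq_abs]
  calc Real.exp (-r) * r ^ n / n.factorial * |f n|
      ≤ Real.exp (-r) * r ^ n / n.factorial *
        (C * (k.factorial * Real.exp 1) * Real.exp 1 ^ n) := by gcongr
    _ = _ := by rw [mul_pow]; ring

/-- The Stein–Chen identity: n r^n/n! = r · r^{n-1}/(n-1)!. Both sides are the same series, so no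
integrability is needed. -/
theorem integral_natCast_mul_poisson (r : ℝ≥0) (f : ℕ → ℝ) :
    ∫ n, (n : ℝ) * f n ∂poissonMeasure r = r * ∫ n, f (n + 1) ∂poissonMeasure r := by
  rw [integral_poissonMeasure, integral_poissonMeasure, ← tsum_mul_left,
    ← (add_left_injective 1).tsum_eq (f := fun n : ℕ =>
      (Real.exp (-r) * r ^ n / n.factorial) • ((n : ℝ) * f n))]
  · refine tsum_congr fun n => ?_
    simp only [smul_eq_mul, Nat.factorial_succ, pow_succ]
    push_cast
    have : (n : ℝ) + 1 ≠ 0 := by positivity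
    field_simp
  · intro n hn
    rcases n with _ | n
    · simp at hn
    · exact ⟨n, rfl⟩

theorem descFactorial_succ_eq (n k : ℕ) :
    n.descFactorial (k + 1) = n * (n - 1).descFactorial k := by
  rcases n with _ | n
  · simp
  · rw [Nat.succ_descFactorial_succ, Nat.add_sub_cancel]

theorem integral_descFactorial_mul_poisson (r : ℝ≥0) (k : ℕ) (f : ℕ → ℝ) :
    ∫ n, (n.descFactorial k : ℝ) * f n ∂poissonMeasure r =
      r ^ k * ∫ n, f (n + k) ∂poissonMeasure r := by
  induction k generalizing f with
  | zero => simp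
  | succ k ih =>
    simp only [descFactorial_succ_eq, Nat.cast_mul, mul_assoc]
    rw [integral_natCast_mul_poisson]
    simp only [Nat.add_sub_cancel]
    rw [ih fun n => f (n + 1), pow_succ]
    simp only [add_assoc]
    ring

theorem integral_descFactorial_poisson (r : ℝ≥0) (k : ℕ) :
    ∫ n, (n.descFactorial k : ℝ) ∂poissonMeasure r = r ^ k := by
  simpa using integral_descFactorial_mul_poisson r k fun _ => 1

/-- Peel off the leading factor n + k. The Stein–Chen identity turns the n-part into r times the
moment of order j, and monotonicity bounds the k-part by k times that moment. -/
theorem integral_descFactorial_add_poisson_le (r : ℝ≥0) (k j : ℕ) :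
    ∫ n, ((n + k).descFactorial j : ℝ) ∂poissonMeasure r ≤ ((r : ℝ) + k) ^ j := by
  induction j with
  | zero => simp
  | succ j ih =>
    have i1 : PolyGrowth fun n => ((n + k).descFactorial j : ℝ) :=
      (PolyGrowth.descFactorial j).comp_add k
    have hle : ∀ n : ℕ, ((n + k - 1).descFactorial j : ℝ) ≤ (n + k).descFactorial j := fun n => by
      exact_mod_cast Nat.descFactorial_le j (by omega)
    have i2 : PolyGrowth fun n => ((n + k - 1).descFactorial j : ℝ) :=
      i1.mono fun n => by rw [Nat.abs_cast, Nat.abs_cast]; exact hle n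
    have e : ∀ n : ℕ, ((n + k).descFactorial (j + 1) : ℝ) =
        n * ((n + k - 1).descFactorial j : ℝ) + k * ((n + k - 1).descFactorial j : ℝ) := by
      intro n
      rw [descFactorial_succ_eq]
      push_cast
      ring
    simp only [e]
    rw [integral_add ((PolyGrowth.natCast.mul i2).integrable r)
      (((PolyGrowth.const _).mul i2).integrable r), integral_natCast_mul_poisson,
      integral_const_mul]
    have e2 : ∀ n : ℕ, n + 1 + k - 1 = n + k := fun n => by omega
    simp only [e2]
    have h2 := integral_mono (i2.integrable r) (i1.integrable r) hle
    calc _ ≤ (r : ℝ) * ∫ n, ((n + k).descFactorial j : ℝ) ∂poissonMeasure r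
          + k * ∫ n, ((n + k).descFactorial j : ℝ) ∂poissonMeasure r := by gcongr
      _ = (r + k) * ∫ n, ((n + k).descFactorial j : ℝ) ∂poissonMeasure r := by ring
      _ ≤ (r + k) * (r + k) ^ j := by gcongr
      _ = _ := by rw [pow_succ]; ring

theorem integral_descFactorial_sq_poisson_le (r : ℝ≥0) (k : ℕ) :
    ∫ n, (n.descFactorial k : ℝ) ^ 2 ∂poissonMeasure r ≤ (r : ℝ) ^ k * ((r : ℝ) + k) ^ k := by
  simp only [sq]
  rw [integral_descFactorial_mul_poisson r k fun n => (n.descFactorial k : ℝ)]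
  gcongr
  exact integral_descFactorial_add_poisson_le r k k

theorem integral_natCast_poisson (r : ℝ≥0) : ∫ n, (n : ℝ) ∂poissonMeasure r = r := by
  simpa using integral_natCast_mul_poisson r fun _ => 1

theorem integral_sub_sq_poisson (r : ℝ≥0) :
    ∫ n, ((n : ℝ) - r) ^ 2 ∂poissonMeasure r = r := by
  have e : ∀ n : ℕ, ((n : ℝ) - r) ^ 2 = n * (n - 2 * r) + r ^ 2 := fun n => by ring
  have i : PolyGrowth fun n => (n : ℝ) * (n - 2 * r) :=
    PolyGrowth.natCast.mul (PolyGrowth.natCast.sub (PolyGrowth.const _))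
  simp only [e]
  rw [integral_add (i.integrable r) (integrable_const _), integral_natCast_mul_poisson]
  push_cast
  rw [integral_sub ((PolyGrowth.natCast.add (PolyGrowth.const 1)).integrable r)
    (integrable_const _), integral_add (PolyGrowth.natCast.integrable r) (integrable_const _),
    integral_natCast_poisson]
  simp
  ring

/-! ### Poisson tail bounds. -/

theorem poisson_real_upper_tail_le (r : ℝ≥0) {a : ℝ} (ha : 0 < a) (hr : r ≤ a) :
    (poissonMeasure r).real {n : ℕ | 2 * a < n} ≤ 1 / a := by
  have i : PolyGrowth fun n => ((n : ℝ) - r) ^ 2 :=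
    (PolyGrowth.natCast.sub (PolyGrowth.const _)).pow 2
  have h : (poissonMeasure r).real {n : ℕ | 2 * a < n} ≤
      ∫ n, (a ^ 2)⁻¹ * ((n : ℝ) - r) ^ 2 ∂poissonMeasure r := by
    rw [← integral_indicator_one (MeasurableSet.of_discrete)]
    refine integral_mono ((integrable_const (1 : ℝ)).indicator MeasurableSet.of_discrete)
      ((i.integrable r).const_mul _) fun n => ?_
    by_cases hn : n ∈ {n : ℕ | 2 * a < n}
    · rw [Set.indicator_of_mem hn, Pi.one_apply, inv_mul_eq_div, le_div_iff₀ (by positivity), one_mul]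
      have : 2 * a < n := hn
      exact pow_le_pow_left₀ ha.le (by linarith) 2
    · rw [Set.indicator_of_notMem hn]
      positivity
  refine h.trans ?_
  rw [integral_const_mul, integral_sub_sq_poisson, inv_mul_eq_div, div_le_div_iff₀ (by positivity) ha]
  nlinarith

theorem integral_exp_neg_poisson (r : ℝ≥0) :
    Integrable (fun n : ℕ => Real.exp (-n)) (poissonMeasure r) ∧
    ∫ n : ℕ, Real.exp (-n) ∂poissonMeasure r = Real.exp (-r * (1 - Real.exp (-1))) := by
  constructor
  · refine PolyGrowth.integrable ((PolyGrowth.const 1).mono fun n => ?_) r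
    rw [abs_of_pos (Real.exp_pos _), abs_one]
    exact Real.exp_le_one_iff.2 (by simp)
  · rw [integral_poissonMeasure]
    have h := (NormedSpace.expSeries_div_hasSum_exp ((r : ℝ) * Real.exp (-1))).mul_left
      (Real.exp (-r))
    rw [← Real.exp_eq_exp_ℝ, ← Real.exp_add] at h
    rw [show -(r : ℝ) * (1 - Real.exp (-1)) = -r + r * Real.exp (-1) by ring, ← h.tsum_eq]
    refine tsum_congr fun n => ?_
    rw [smul_eq_mul, mul_pow, ← Real.exp_nat_mul]
    ring_nf

theorem poisson_real_lower_tail_le (r : ℝ≥0) {a : ℝ} (ha : a ≤ r / 2) :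
    (poissonMeasure r).real {n : ℕ | (n : ℝ) ≤ a} ≤ Real.exp (-(r / 8)) := by
  obtain ⟨i, hi⟩ := integral_exp_neg_poisson r
  have h : (poissonMeasure r).real {n : ℕ | (n : ℝ) ≤ a} ≤
      ∫ n : ℕ, Real.exp (r / 2) * Real.exp (-n) ∂poissonMeasure r := by
    rw [← integral_indicator_one (MeasurableSet.of_discrete)]
    refine integral_mono ((integrable_const (1 : ℝ)).indicator MeasurableSet.of_discrete)
      (i.const_mul _) fun n => ?_
    by_cases hn : n ∈ {n : ℕ | (n : ℝ) ≤ a}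
    · rw [Set.indicator_of_mem hn, Pi.one_apply, ← Real.exp_add]
      have : (n : ℝ) ≤ a := hn
      exact Real.one_le_exp (by linarith)
    · rw [Set.indicator_of_notMem hn]
      positivity
  refine h.trans ?_
  rw [integral_const_mul, hi, ← Real.exp_add, Real.exp_le_exp]
  -- The Chernoff exponent is r/2 - r(1 - 1/e), which is at most r/2 - 5r/8 = -r/8.
  have he : Real.exp (-1) ≤ 3 / 8 := by
    rw [Real.exp_neg, inv_le_comm₀ (Real.exp_pos _) (by norm_num)]
    linarith [Real.exp_one_gt_d9]
  nlinarith [r.coe_nonneg]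

/-! ### Fractional Poisson moments, from tangent lines and the Stein–Chen identity. -/

theorem rpow_le_tangent {a x y : ℝ} (ha : 0 ≤ a) (ha1 : a ≤ 1) (hx : 0 ≤ x) (hy : 0 < y) :
    x ^ a ≤ y ^ a + a * y ^ (a - 1) * (x - y) := by
  have h := rpow_one_add_le_one_add_mul_self (s := x / y - 1)
    (by have := div_nonneg hx hy.le; linarith) ha ha1
  rw [add_sub_cancel, Real.div_rpow hx hy.le, div_le_iff₀ (by positivity)] at h
  rw [Real.rpow_sub_one hy.ne']
  refine h.trans_eq ?_
  field_simp

theorem tangent_le_rpow {a x y : ℝ} (ha1 : 1 ≤ a) (hx : 0 ≤ x) (hy : 0 < y) :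
    y ^ a + a * y ^ (a - 1) * (x - y) ≤ x ^ a := by
  have h := one_add_mul_self_le_rpow_one_add (s := x / y - 1)
    (by have := div_nonneg hx hy.le; linarith) ha1
  rw [add_sub_cancel, Real.div_rpow hx hy.le, le_div_iff₀ (by positivity)] at h
  rw [Real.rpow_sub_one hy.ne']
  refine Eq.trans_le ?_ h
  field_simp

/-- Jensen's inequality, obtained by integrating the tangent line at the mean r + b. With b = 0 or
after one or two Stein–Chen shifts it serves all exponents up to 3. -/
theorem integral_add_rpow_poisson_le (r : ℝ≥0) {a b : ℝ} (ha : 0 ≤ a) (ha1 : a ≤ 1) (hb : 0 ≤ b)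
    (hrb : 0 < r + b) :
    ∫ n, ((n : ℝ) + b) ^ a ∂poissonMeasure r ≤ (r + b) ^ a := by
  have i : PolyGrowth fun n => ((r : ℝ) + b) ^ a + a * (r + b) ^ (a - 1) * (n - r) :=
    (PolyGrowth.const _).add
      ((PolyGrowth.const _).mul (PolyGrowth.natCast.sub (PolyGrowth.const _)))
  have hle : ∀ n : ℕ, ((n : ℝ) + b) ^ a ≤ (r + b) ^ a + a * (r + b) ^ (a - 1) * (n - r) := by
    intro n
    have := rpow_le_tangent ha ha1 (by positivity : 0 ≤ (n : ℝ) + b) hrb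
    rwa [add_sub_add_right_eq_sub] at this
  have i2 : PolyGrowth fun n => ((n : ℝ) + b) ^ a := i.mono fun n => by
    rw [abs_of_nonneg (by positivity)]
    exact (hle n).trans (le_abs_self _)
  refine (integral_mono (i2.integrable r) (i.integrable r) hle).trans_eq ?_
  rw [integral_add (integrable_const _) (((PolyGrowth.const _).mul
    (PolyGrowth.natCast.sub (PolyGrowth.const _))).integrable r), integral_const_mul,
    integral_sub (PolyGrowth.natCast.integrable r) (integrable_const _), integral_natCast_poisson]
  simp

theorem le_integral_rpow_poisson (r : ℝ≥0) {a : ℝ} (ha : 1 ≤ a) :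
    (r : ℝ) ^ a ≤ ∫ n, (n : ℝ) ^ a ∂poissonMeasure r := by
  rcases (zero_le (a := r)).eq_or_lt with hr | hr
  · rw [← hr, NNReal.coe_zero, Real.zero_rpow (by linarith)]
    exact integral_nonneg fun n => by positivity
  · have hr' : (0 : ℝ) < r := hr
    have i : PolyGrowth fun n => (r : ℝ) ^ a + a * r ^ (a - 1) * (n - r) :=
      (PolyGrowth.const _).add
        ((PolyGrowth.const _).mul (PolyGrowth.natCast.sub (PolyGrowth.const _)))
    refine Eq.trans_le ?_ (integral_mono (i.integrable r)
      ((PolyGrowth.rpow (by linarith)).integrable r)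
      fun n => tangent_le_rpow ha n.cast_nonneg hr')
    rw [integral_add (integrable_const _) (((PolyGrowth.const _).mul
      (PolyGrowth.natCast.sub (PolyGrowth.const _))).integrable r), integral_const_mul,
      integral_sub (PolyGrowth.natCast.integrable r) (integrable_const _),
      integral_natCast_poisson]
    simp

theorem natCast_rpow_eq_mul {a : ℝ} (ha : a ≠ 0) (n : ℕ) :
    (n : ℝ) ^ a = n * (n : ℝ) ^ (a - 1) := by
  rcases n.eq_zero_or_pos with rfl | hn
  · simp [Real.zero_rpow ha]
  · have : (0 : ℝ) < n := by exact_mod_cast hn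
    rw [Real.rpow_sub_one this.ne']
    field_simp

theorem integral_rpow_poisson_le (r : ℝ≥0) {a : ℝ} (ha : 1 ≤ a) (ha2 : a ≤ 2) :
    ∫ n, (n : ℝ) ^ a ∂poissonMeasure r ≤ r * (r + 1) ^ (a - 1) := by
  simp only [natCast_rpow_eq_mul (by linarith : a ≠ 0)]
  rw [integral_natCast_mul_poisson]
  push_cast
  gcongr
  exact integral_add_rpow_poisson_le r (by linarith) (by linarith) zero_le_one (by positivity)

theorem integral_rpow_poisson_le' (r : ℝ≥0) {a : ℝ} (ha : 2 ≤ a) (ha3 : a ≤ 3) :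
    ∫ n, (n : ℝ) ^ a ∂poissonMeasure r ≤ r * (r * (r + 2) ^ (a - 2) + (r + 1) ^ (a - 2)) := by
  have e : ∀ n : ℕ, ((n + 1 : ℕ) : ℝ) ^ (a - 1) =
      n * ((n + 1 : ℕ) : ℝ) ^ (a - 2) + ((n + 1 : ℕ) : ℝ) ^ (a - 2) := by
    intro n
    rw [natCast_rpow_eq_mul (by linarith : a - 1 ≠ 0), show a - 1 - 1 = a - 2 by ring]
    push_cast
    ring
  have i : PolyGrowth fun n => ((n + 1 : ℕ) : ℝ) ^ (a - 2) :=
    (PolyGrowth.rpow (by linarith : 0 ≤ a - 2)).comp_add 1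
  simp only [natCast_rpow_eq_mul (by linarith : a ≠ 0)]
  rw [integral_natCast_mul_poisson]
  simp only [e]
  rw [integral_add ((PolyGrowth.natCast.mul i).integrable r) (i.integrable r),
    integral_natCast_mul_poisson]
  push_cast
  simp only [add_assoc, one_add_one_eq_two]
  gcongr
  · exact integral_add_rpow_poisson_le r (by linarith) (by linarith) zero_le_two (by positivity)
  · exact integral_add_rpow_poisson_le r (by linarith) (by linarith) zero_le_one (by positivity)

theorem integral_rpow_poisson_le_rpow (r : ℝ≥0) {a : ℝ} (ha : 0 < a) (ha1 : a ≤ 1) :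
    ∫ n, (n : ℝ) ^ a ∂poissonMeasure r ≤ (r : ℝ) ^ a := by
  rcases (zero_le (a := r)).eq_or_lt with hr | hr
  · rw [← hr, integral_poissonMeasure, tsum_eq_single 0]
    · simp [Real.zero_rpow ha.ne']
    · intro n hn
      simp [hn]
  · have hr' : (0 : ℝ) < r := hr
    simpa using integral_add_rpow_poisson_le r ha.le ha1 le_rfl (by simpa using hr')

theorem add_rpow_le_add_mul {a x b : ℝ} (ha : 0 ≤ a) (ha1 : a ≤ 1) (hb : 0 ≤ b) (hx : 0 < x) :
    (x + b) ^ a ≤ x ^ a + b * x ^ (a - 1) := by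
  refine (rpow_le_tangent ha ha1 (by positivity : 0 ≤ x + b) hx).trans ?_
  rw [add_sub_cancel_left]
  have : 0 ≤ x ^ (a - 1) * b := by positivity
  nlinarith

theorem integral_rpow_poisson_sub_le (r : ℝ≥0) {a : ℝ} (ha : 1 ≤ a) (ha2 : a ≤ 2) (hr : 0 < r) :
    ∫ n, (n : ℝ) ^ a ∂poissonMeasure r ≤ (r : ℝ) ^ a + r ^ (a - 1) := by
  have hr' : (0 : ℝ) < r := hr
  refine (integral_rpow_poisson_le r ha ha2).trans ?_
  have h := add_rpow_le_add_mul (a := a - 1) (by linarith) (by linarith) zero_le_one hr'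
  refine (mul_le_mul_of_nonneg_left h hr'.le).trans_eq ?_
  rw [Real.rpow_sub_one hr'.ne' (a - 1), Real.rpow_sub_one hr'.ne' a]
  field_simp

/-- Linearizing (r+2)^{a-2} and (r+1)^{a-2} leaves excess terms with coefficients 2, 1 and 1. The
assumption r ≥ 1 absorbs the lowest order into r^{a-1}, giving 4. -/
theorem integral_rpow_poisson_sub_le' (r : ℝ≥0) {a : ℝ} (ha : 2 ≤ a) (ha3 : a ≤ 3) (hr : 1 ≤ r) :
    ∫ n, (n : ℝ) ^ a ∂poissonMeasure r ≤ (r : ℝ) ^ a + 4 * r ^ (a - 1) := by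
  have hr1 : (1 : ℝ) ≤ r := hr
  have hr' : (0 : ℝ) < r := by linarith
  refine (integral_rpow_poisson_le' r ha ha3).trans ?_
  have h1 := add_rpow_le_add_mul (a := a - 2) (by linarith) (by linarith) zero_le_two hr'
  have h2 := add_rpow_le_add_mul (a := a - 2) (by linarith) (by linarith) zero_le_one hr'
  have e1 : (r : ℝ) ^ a = r * (r * r ^ (a - 2)) := by
    rw [← Real.rpow_one_add' hr'.le (by linarith), ← Real.rpow_one_add' hr'.le (by linarith)]
    ring_nf
  have e2 : (r : ℝ) ^ (a - 1) = r * r ^ (a - 2) := by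
    rw [← Real.rpow_one_add' hr'.le (by linarith)]
    ring_nf
  have e3 : (r : ℝ) ^ (a - 2) = r * r ^ (a - 2 - 1) := by
    rw [Real.rpow_sub_one hr'.ne']
    field_simp
  have h3 : (r : ℝ) ^ (a - 2 - 1) ≤ r ^ (a - 2) := by
    rw [e3]
    exact le_mul_of_one_le_left (by positivity) hr1
  calc (r : ℝ) * (r * (r + 2) ^ (a - 2) + (r + 1) ^ (a - 2))
      ≤ r * (r * (r ^ (a - 2) + 2 * r ^ (a - 2 - 1)) + (r ^ (a - 2) + 1 * r ^ (a - 2 - 1))) := by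
        gcongr
    _ = r * (r * r ^ (a - 2)) + r * (3 * r ^ (a - 2) + r ^ (a - 2 - 1)) := by rw [e3]; ring
    _ ≤ r * (r * r ^ (a - 2)) + r * (3 * r ^ (a - 2) + r ^ (a - 2)) := by gcongr
    _ = _ := by rw [e1, e2]; ring

/-! ### Splitting of Poisson counts and the risk -/

theorem binomial_mul_poisson_singleton (r : ℝ≥0) (x y : ℕ) :
    binomial (x + y) ⟨1 / 2, by norm_num, by norm_num⟩ {x} * poissonMeasure r {x + y} =
      poissonMeasure (r / 2) {x} * poissonMeasure (r / 2) {y} := by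
  simp only [binomial_singleton, poissonMeasure_singleton]
  rw [← ENNReal.ofReal_mul (by positivity), ← ENNReal.ofReal_mul (by positivity)]
  congr 1
  have hc : ((x + y).choose x : ℝ) = (x + y).factorial / (x.factorial * y.factorial) := by
    rw [Nat.cast_choose ℝ (Nat.le_add_right x y), Nat.add_sub_cancel_left]
  have he : Real.exp (-(r : ℝ)) = Real.exp (-((r / 2 : ℝ≥0) : ℝ)) * Real.exp (-((r / 2 : ℝ≥0) : ℝ)) := by
    rw [← Real.exp_add]
    congr 1
    push_cast
    ring
  rw [hc, he, Nat.add_sub_cancel_left]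
  push_cast
  have h1 : (x.factorial : ℝ) ≠ 0 := by positivity
  have h2 : (y.factorial : ℝ) ≠ 0 := by positivity
  have h3 : ((x + y).factorial : ℝ) ≠ 0 := by positivity
  rw [show (1 - 1 / 2 : ℝ) = 1 / 2 by norm_num, div_pow, div_pow, div_pow, div_pow, pow_add,
    one_pow, one_pow]
  field_simp

theorem splitCounts_singleton_of_eq {S : ℕ} (x y : Fin S → ℕ) :
    splitCounts (x + y) {(x, y)} =
      ∏ i, binomial (x i + y i) ⟨1 / 2, by norm_num, by norm_num⟩ {x i} := by
  rw [splitCounts, Measure.map_apply .of_discrete .of_discrete,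
    ← Measure.pi_singleton]
  congr 1
  ext T
  simp only [Set.mem_preimage, Set.mem_singleton_iff, Prod.mk.injEq]
  constructor
  · exact fun h => h.1
  · rintro rfl
    exact ⟨rfl, by ext i; simp⟩

/-- Natural subtraction truncates, so Z - x = y does not force Z = x + y. In that case some Z i < x
i, and the binomial law gives x i no mass. -/
theorem splitCounts_singleton_of_ne {S : ℕ} {Z x y : Fin S → ℕ} (h : Z ≠ x + y) :
    splitCounts Z {(x, y)} = 0 := by
  rw [splitCounts, Measure.map_apply .of_discrete .of_discrete]
  by_cases hy : (fun i => Z i - x i) = y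
  · have hi : ∃ i, Z i < x i := by
      by_contra! hc
      refine h (funext fun i => ?_)
      have := congrFun hy i
      rw [Pi.add_apply]
      have := hc i
      omega
    obtain ⟨i, hi⟩ := hi
    refine measure_mono_null (t := {x}) ?_ ?_
    · intro T hT
      simp only [Set.mem_preimage, Set.mem_singleton_iff, Prod.mk.injEq] at hT
      exact hT.1
    · rw [Measure.pi_singleton]
      refine Finset.prod_eq_zero (Finset.mem_univ i) ?_
      rw [binomial_singleton, Nat.choose_eq_zero_of_lt hi]
      simp
  · convert measure_empty using 2
    · ext T
      simp only [Set.mem_preimage, Set.mem_singleton_iff, Prod.mk.injEq, Set.mem_empty_iff_false,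
        iff_false]
      rintro ⟨rfl, h2⟩
      exact hy h2
    · infer_instance

/-- The two halves of the split counts are independent, with Poisson coordinates. -/
theorem splitPoissonCounts_eq_map (n : ℕ) {S : ℕ} (P : Fin S → ℝ) :
    splitPoissonCounts n P =
      (Measure.pi fun i => (poissonMeasure ((n : ℝ≥0) * (P i).toNNReal / 2)).prod
        (poissonMeasure ((n : ℝ≥0) * (P i).toNNReal / 2))).map
        fun z => (fun i => (z i).1, fun i => (z i).2) := by
  refine Measure.ext_of_singleton fun ⟨x, y⟩ => ?_
  rw [splitPoissonCounts, Measure.bind_apply .of_discrete (Measurable.of_discrete).aemeasurable,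
    Measure.map_apply .of_discrete .of_discrete]
  -- Only Z = x + y can produce (x, y), so the mixture over Z collapses to one term, and Poisson
  -- thinning applies coordinatewise.
  have h1 : ∀ Z : Fin S → ℕ, splitCounts Z {(x, y)} =
      ({x + y} : Set (Fin S → ℕ)).indicator (fun _ => splitCounts (x + y) {(x, y)}) Z := by
    intro Z
    by_cases h : Z = x + y
    · rw [h, Set.indicator_of_mem (Set.mem_singleton _)]
    · rw [Set.indicator_of_notMem (by simpa using h), splitCounts_singleton_of_ne h]
  have h2 : (fun z : Fin S → ℕ × ℕ => ((fun i => (z i).1 : Fin S → ℕ), (fun i => (z i).2 : Fin S → ℕ)))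
      ⁻¹' {(x, y)} = {fun i => (x i, y i)} := by
    ext z
    simp only [Set.mem_preimage, Set.mem_singleton_iff, Prod.mk.injEq]
    constructor
    · rintro ⟨rfl, rfl⟩
      rfl
    · rintro rfl
      exact ⟨rfl, rfl⟩
  rw [lintegral_congr h1, lintegral_indicator .of_discrete, setLIntegral_const, splitCounts_singleton_of_eq, h2,
    Measure.pi_singleton, poissonCounts, Measure.pi_singleton, ← Finset.prod_mul_distrib]
  refine Finset.prod_congr rfl fun i _ => ?_
  rw [← Set.singleton_prod_singleton, Measure.prod_prod, Pi.add_apply,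
    binomial_mul_poisson_singleton]

/-- Bias–variance decomposition: by independence the variances add, each being at most the mean
squared error about c i, while the biases add before squaring. -/
theorem lintegral_pi_sum_sub_sq_le {ι Ω : Type*} [Fintype ι] [MeasurableSpace Ω]
    (μ : ι → Measure Ω) [∀ i, IsProbabilityMeasure (μ i)] (h : ι → Ω → ℝ)
    (hh : ∀ i, MemLp (h i) 2 (μ i)) (c b v : ι → ℝ)
    (hb : ∀ i, |∫ z, h i z ∂μ i - c i| ≤ b i) (hv : ∀ i, ∫ z, (h i z - c i) ^ 2 ∂μ i ≤ v i) :
    ∫⁻ z, ENNReal.ofReal ((∑ i, h i (z i) - ∑ i, c i) ^ 2) ∂Measure.pi μ ≤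
      ENNReal.ofReal (∑ i, v i + (∑ i, b i) ^ 2) := by
  set X : ι → (ι → Ω) → ℝ := fun i z => h i (z i) with hX
  have hXL : ∀ i, MemLp (X i) 2 (Measure.pi μ) := fun i =>
    (hh i).comp_measurePreserving (measurePreserving_eval μ i)
  have hindep : iIndepFun X (Measure.pi μ) := iIndepFun_pi fun i => (hh i).1.aemeasurable
  have hvar : variance (∑ i, X i) (Measure.pi μ) = ∑ i, variance (X i) (Measure.pi μ) :=
    IndepFun.variance_sum (fun i _ => hXL i) fun i _ j _ hij => hindep.indepFun hij
  have hvar1 : ∀ i, variance (X i) (Measure.pi μ) ≤ v i := by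
    intro i
    rw [← variance_sub_const (hXL i).1 (c i)]
    refine (variance_le_expectation_sq ((hXL i).1.sub aestronglyMeasurable_const)).trans ?_
    refine le_trans (le_of_eq ?_) (hv i)
    exact integral_comp_eval (μ := μ) (f := fun w => (h i w - c i) ^ 2) (i := i)
      (((hh i).1.sub (aestronglyMeasurable_const (b := c i))).pow 2)
  have hmean : ∀ i, ∫ z, X i z ∂Measure.pi μ = ∫ w, h i w ∂μ i := fun i =>
    integral_comp_eval (hh i).1
  have hW : MemLp (fun z => ∑ i, X i z - ∑ i, c i) 2 (Measure.pi μ) :=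
    (memLp_finsetSum _ fun i _ => hXL i).sub (memLp_const _)
  rw [← ofReal_integral_eq_lintegral_ofReal hW.integrable_sq (ae_of_all _ fun z => sq_nonneg _)]
  refine ENNReal.ofReal_le_ofReal ?_
  have h1 := variance_eq_sub hW
  have h2 : variance (fun z => ∑ i, X i z - ∑ i, c i) (Measure.pi μ) =
      variance (∑ i, X i) (Measure.pi μ) := by
    rw [← variance_sub_const (memLp_finsetSum' _ fun i _ => hXL i).1 (∑ i, c i)]
    congr 1
    ext z
    simp
  have h3 : ∫ z, (∑ i, X i z - ∑ i, c i) ∂Measure.pi μ = ∑ i, (∫ w, h i w ∂μ i - c i) := by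
    rw [integral_sub (integrable_finsetSum _ fun i _ => (hXL i).integrable one_le_two)
      (integrable_const _), integral_finsetSum _ fun i _ => (hXL i).integrable one_le_two,
      Finset.sum_sub_distrib]
    simp [hmean]
  have h4 : |∑ i, (∫ w, h i w ∂μ i - c i)| ≤ ∑ i, b i :=
    (Finset.abs_sum_le_sum_abs _ _).trans (Finset.sum_le_sum fun i _ => hb i)
  have h5 : (∑ i, (∫ w, h i w ∂μ i - c i)) ^ 2 ≤ (∑ i, b i) ^ 2 :=
    sq_le_sq.2 (h4.trans (le_abs_self _))
  rw [h2, hvar] at h1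
  have h6 : ∑ i, variance (X i) (Measure.pi μ) ≤ ∑ i, v i := Finset.sum_le_sum fun i _ => hvar1 i
  have h7 : ∫ z, (∑ i, X i z - ∑ i, c i) ^ 2 ∂Measure.pi μ =
      (Measure.pi μ)[(fun z => ∑ i, X i z - ∑ i, c i) ^ 2] := rfl
  rw [h3] at h1
  change ∫ z, (∑ i, X i z - ∑ i, c i) ^ 2 ∂Measure.pi μ ≤ _
  rw [h7]
  linarith

/-- The contribution of a symbol with split counts `z` to the estimator. -/
def symbolEstimator (α c₁ c₂ m : ℝ) (z : ℕ × ℕ) : ℝ :=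
  if (z.2 : ℝ) / m ≤ 2 * threshold c₁ m then lowerPart α c₁ c₂ m ((z.1 : ℝ) / m)
  else upperPart α c₁ m ((z.1 : ℝ) / m)

theorem risk_le_of_symbol_bounds {α c₁ c₂ : ℝ} {n : ℕ} {S : ℕ} {P : Fin S → ℝ}
    (hL : ∀ r : ℝ≥0, MemLp (symbolEstimator α c₁ c₂ ((n : ℝ) / 2)) 2
      ((poissonMeasure r).prod (poissonMeasure r)))
    (b v : Fin S → ℝ)
    (hb : ∀ i, |∫ z, symbolEstimator α c₁ c₂ ((n : ℝ) / 2) z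
      ∂(poissonMeasure ((n : ℝ≥0) * (P i).toNNReal / 2)).prod
        (poissonMeasure ((n : ℝ≥0) * (P i).toNNReal / 2)) - P i ^ α| ≤ b i)
    (hv : ∀ i, ∫ z, (symbolEstimator α c₁ c₂ ((n : ℝ) / 2) z - P i ^ α) ^ 2
      ∂(poissonMeasure ((n : ℝ≥0) * (P i).toNNReal / 2)).prod
        (poissonMeasure ((n : ℝ≥0) * (P i).toNNReal / 2)) ≤ v i) :
    risk α c₁ c₂ n P ≤ ENNReal.ofReal (∑ i, v i + (∑ i, b i) ^ 2) := by
  rw [risk, splitPoissonCounts_eq_map, lintegral_map .of_discrete .of_discrete]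
  exact lintegral_pi_sum_sub_sq_le _ (fun _ => symbolEstimator α c₁ c₂ ((n : ℝ) / 2))
    (fun i => hL _) (fun i => P i ^ α) b v hb hv

/-! ### The estimator for large probabilities -/

theorem smoothStep_mem_Icc {x a : ℝ} (ha : 0 < a) (hx : 0 ≤ x) (hxa : x ≤ a) :
    smoothStep x a ∈ Set.Icc (0 : ℝ) 1 := by
  have hu : 0 ≤ x / a := by positivity
  have hv : 0 ≤ 1 - x / a := by rw [sub_nonneg, div_le_one ha]; exact hxa
  rw [smoothStep]
  set u := x / a
  -- The step satisfies g(u) = 1 - g(1-u), and g(u)/u⁵ has positive coefficients in powers of 1-u.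
  -- The two forms exhibit the bounds 0 and 1.
  have e1 : 126 * u ^ 5 - 420 * u ^ 6 + 540 * u ^ 7 - 315 * u ^ 8 + 70 * u ^ 9 =
      u ^ 5 * (1 + 5 * (1 - u) + 15 * (1 - u) ^ 2 + 35 * (1 - u) ^ 3 + 70 * (1 - u) ^ 4) := by ring
  have e2 : 126 * u ^ 5 - 420 * u ^ 6 + 540 * u ^ 7 - 315 * u ^ 8 + 70 * u ^ 9 =
      1 - (1 - u) ^ 5 * (1 + 5 * u + 15 * u ^ 2 + 35 * u ^ 3 + 70 * u ^ 4) := by ring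
  constructor
  · rw [e1]; positivity
  · rw [e2, sub_le_self_iff]; positivity

theorem interp_mem_Icc {t : ℝ} (ht : 0 < t) (x : ℝ) : interp t x ∈ Set.Icc (0 : ℝ) 1 := by
  unfold interp
  split_ifs with h1 h2
  · norm_num
  · exact smoothStep_mem_Icc ht (by linarith) (by linarith)
  · norm_num

theorem upperPart_natCast_div {α c₁ m : ℝ} (hm : 0 < m) (N : ℕ) :
    upperPart α c₁ m ((N : ℝ) / m) = interp (threshold c₁ m / 4) ((N : ℝ) / m) *
      (1 - α * (α - 1) / (2 * N)) * ((N : ℝ) ^ α / m ^ α) := by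
  rw [upperPart, Real.div_rpow N.cast_nonneg hm.le]
  have : 2 * m * ((N : ℝ) / m) = 2 * N := by field_simp
  rw [this]
  ring

theorem correction_mem_Icc {α : ℝ} (hα : 1 < α) (hα2 : α < 3 / 2) {N : ℕ} (hN : 1 ≤ N) :
    α * (α - 1) / (2 * N) ∈ Set.Icc (0 : ℝ) (1 / N) ∧ (1 : ℝ) / N ≤ 1 := by
  have hN' : (1 : ℝ) ≤ N := by exact_mod_cast hN
  have h1 : 0 ≤ α * (α - 1) := mul_nonneg (by linarith) (by linarith)
  refine ⟨⟨by positivity, ?_⟩, ?_⟩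
  · rw [div_le_div_iff₀ (by positivity) (by positivity)]
    have h2 : α * (α - 1) ≤ 2 := by nlinarith
    have := mul_le_mul_of_nonneg_right h2 N.cast_nonneg
    linarith
  · rw [div_le_one (by positivity)]
    exact hN'

theorem upperPart_mem_Icc {α c₁ m : ℝ} (hα : 1 < α) (hα2 : α < 3 / 2) (hm : 0 < m)
    (hΔ : 0 < threshold c₁ m) (N : ℕ) :
    upperPart α c₁ m ((N : ℝ) / m) ∈ Set.Icc 0 ((N : ℝ) ^ α / m ^ α) := by
  rw [upperPart_natCast_div hm]
  rcases Nat.eq_zero_or_pos N with rfl | hN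
  · simp [Real.zero_rpow (by linarith : α ≠ 0)]
  · obtain ⟨hI0, hI1⟩ := interp_mem_Icc (by positivity : 0 < threshold c₁ m / 4) ((N : ℝ) / m)
    obtain ⟨⟨h0, h1⟩, h2⟩ := correction_mem_Icc hα hα2 hN
    have hq : 0 ≤ (N : ℝ) ^ α / m ^ α := by positivity
    have h3 : 0 ≤ 1 - α * (α - 1) / (2 * N) := by linarith
    refine ⟨by positivity, mul_le_of_le_one_left hq (mul_le_one₀ hI1 h3 (by linarith))⟩

/-- The interpolation alters the plug-in value only for N ≤ 2tm = mΔ/2, where N^α is at most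
(mΔ/2)^α. The second-order correction has relative size at most 1/N and is treated here as an error.
-/
theorem abs_upperPart_sub_le {α c₁ m : ℝ} (hα : 1 < α) (hα2 : α < 3 / 2) (hm : 0 < m)
    (hΔ : 0 < threshold c₁ m) (N : ℕ) :
    |upperPart α c₁ m ((N : ℝ) / m) - (N : ℝ) ^ α / m ^ α| ≤
      ({n : ℕ | (n : ℝ) ≤ m * threshold c₁ m / 2}.indicator
        (fun _ => (m * threshold c₁ m / 2) ^ α) N + (N : ℝ) ^ (α - 1)) / m ^ α := by
  set a := m * threshold c₁ m / 2 with ha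
  have ha0 : 0 < a := by positivity
  have hind : 0 ≤ {n : ℕ | (n : ℝ) ≤ a}.indicator (fun _ => a ^ α) N :=
    Set.indicator_nonneg (fun _ _ => by positivity) _
  rw [upperPart_natCast_div hm]
  rcases Nat.eq_zero_or_pos N with rfl | hN
  · simp only [Nat.cast_zero, Real.zero_rpow (by linarith : α ≠ 0), zero_div, mul_zero, sub_zero,
      abs_zero]
    positivity
  · have hN' : (1 : ℝ) ≤ N := by exact_mod_cast hN
    obtain ⟨hI0, hI1⟩ := interp_mem_Icc (by positivity : 0 < threshold c₁ m / 4) ((N : ℝ) / m)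
    obtain ⟨⟨h0, h1⟩, h2⟩ := correction_mem_Icc hα hα2 hN
    set I := interp (threshold c₁ m / 4) ((N : ℝ) / m) with hI
    set δ := α * (α - 1) / (2 * (N : ℝ)) with hδ
    have e : I * (1 - δ) * ((N : ℝ) ^ α / m ^ α) - (N : ℝ) ^ α / m ^ α =
        -(((1 - I) * (N : ℝ) ^ α + I * δ * (N : ℝ) ^ α) / m ^ α) := by ring
    have hI1' : 0 ≤ 1 - I := by linarith
    rw [e, abs_neg, abs_of_nonneg (by positivity)]
    gcongr
    · by_cases hNa : (N : ℝ) ≤ a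
      · rw [Set.indicator_of_mem (by exact hNa)]
        calc (1 - I) * (N : ℝ) ^ α ≤ 1 * (N : ℝ) ^ α := by gcongr; linarith
          _ ≤ a ^ α := by rw [one_mul]; gcongr
      · have hIone : I = 1 := by
          rw [not_le] at hNa
          have h3 : 2 * (threshold c₁ m / 4) < N / m := by
            rw [lt_div_iff₀ hm]
            rw [ha] at hNa
            linarith
          rw [hI, interp, if_neg (by linarith), if_neg (by linarith)]
        rw [hIone, sub_self, zero_mul]
        exact hind
    · rw [Real.rpow_sub_one (by positivity), div_eq_mul_one_div, mul_comm]
      gcongr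
      calc I * δ ≤ 1 * δ := by gcongr
        _ ≤ 1 / N := by rw [one_mul]; exact h1

theorem PolyGrowth.upperPart {α c₁ m : ℝ} (hα : 1 < α) (hα2 : α < 3 / 2) (hm : 0 < m)
    (hΔ : 0 < threshold c₁ m) : PolyGrowth fun N => upperPart α c₁ m ((N : ℝ) / m) :=
  ((PolyGrowth.rpow (by linarith : 0 ≤ α)).mul (PolyGrowth.const (m ^ α)⁻¹)).mono fun N => by
    obtain ⟨h0, h1⟩ := upperPart_mem_Icc hα hα2 hm hΔ N
    rw [abs_of_nonneg h0, ← div_eq_mul_inv]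
    exact h1.trans (le_abs_self _)

theorem integral_upperPart_le {α c₁ m : ℝ} (hα : 1 < α) (hα2 : α < 3 / 2) (hm : 0 < m)
    (hΔ : 0 < threshold c₁ m) (r : ℝ≥0) :
    |∫ N, upperPart α c₁ m ((N : ℝ) / m) ∂poissonMeasure r| ≤ r * (r + 1) ^ (α - 1) / m ^ α := by
  rw [abs_of_nonneg (integral_nonneg fun N => (upperPart_mem_Icc hα hα2 hm hΔ N).1)]
  refine (integral_mono ((PolyGrowth.upperPart hα hα2 hm hΔ).integrable r)
    (((PolyGrowth.rpow (by linarith : 0 ≤ α)).integrable r).div_const _)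
    fun N => (upperPart_mem_Icc hα hα2 hm hΔ N).2).trans ?_
  rw [integral_div]
  gcongr
  exact integral_rpow_poisson_le r hα.le (by linarith)

theorem sq_rpow_natCast (N : ℕ) (a : ℝ) : ((N : ℝ) ^ a) ^ 2 = (N : ℝ) ^ (2 * a) := by
  rw [← Real.rpow_natCast, ← Real.rpow_mul N.cast_nonneg, mul_comm]
  norm_num

theorem integral_upperPart_sq_le {α c₁ m : ℝ} (hα : 1 < α) (hα2 : α < 3 / 2) (hm : 0 < m)
    (hΔ : 0 < threshold c₁ m) (r : ℝ≥0) :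
    ∫ N, upperPart α c₁ m ((N : ℝ) / m) ^ 2 ∂poissonMeasure r ≤
      r * (r + 2) ^ (2 * α - 1) / (m ^ α) ^ 2 := by
  have i : PolyGrowth fun N => (N : ℝ) ^ (2 * α) := PolyGrowth.rpow (by linarith)
  refine (integral_mono (((PolyGrowth.upperPart hα hα2 hm hΔ).pow 2).integrable r)
    ((i.integrable r).div_const ((m ^ α) ^ 2)) fun N => ?_).trans ?_
  · obtain ⟨h0, h1⟩ := upperPart_mem_Icc hα hα2 hm hΔ N
    rw [← sq_rpow_natCast, ← div_pow]
    exact pow_le_pow_left₀ h0 h1 2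
  · rw [integral_div]
    gcongr
    refine (integral_rpow_poisson_le' r (by linarith) (by linarith)).trans ?_
    gcongr
    have e : ((r : ℝ) + 2) ^ (2 * α - 1) = (r + 2) ^ (2 * α - 2) * (r + 2) := by
      rw [← Real.rpow_add_one' (by positivity) (by linarith)]
      ring_nf
    have h : ((r : ℝ) + 1) ^ (2 * α - 2) ≤ (r + 2) ^ (2 * α - 2) := by
      refine Real.rpow_le_rpow (by positivity) ?_ (by linarith)
      linarith
    have h2 : 0 ≤ ((r : ℝ) + 2) ^ (2 * α - 2) := by positivity
    rw [e]
    linarith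

/-! ### Bias and mean squared error of `upperPart` for Poisson mean at least mΔ. -/

section LargeProbability

variable {α c₁ m : ℝ} {r : ℝ≥0}

theorem lower_tail_mul_le (hr : 1 ≤ r) {a : ℝ} (ha : a ≤ r / 2) :
    (poissonMeasure r).real {n : ℕ | (n : ℝ) ≤ a} ≤ 8 / r := by
  have hr' : (0 : ℝ) < r := lt_of_lt_of_le one_pos (by exact_mod_cast hr)
  refine (poisson_real_lower_tail_le r ha).trans ?_
  rw [Real.exp_neg, inv_le_comm₀ (Real.exp_pos _) (by positivity), inv_div]
  linarith [Real.add_one_le_exp ((r : ℝ) / 8)]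

theorem integrable_tail_indicator (a c : ℝ) :
    Integrable ({n : ℕ | (n : ℝ) ≤ a}.indicator fun _ => c) (poissonMeasure r) :=
  (integrable_const c).indicator MeasurableSet.of_discrete

theorem integral_tail_indicator (a c : ℝ) :
    ∫ n, {n : ℕ | (n : ℝ) ≤ a}.indicator (fun _ => c) n ∂poissonMeasure r =
      (poissonMeasure r).real {n : ℕ | (n : ℝ) ≤ a} * c := by
  rw [integral_indicator_const _ MeasurableSet.of_discrete, smul_eq_mul]

theorem abs_integral_upperPart_sub_le (hα : 1 < α) (hα2 : α < 3 / 2) (hm : 0 < m)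
    (hΔ : 0 < threshold c₁ m) (hr : 1 ≤ r) (hrΔ : m * threshold c₁ m ≤ r) :
    |∫ N, upperPart α c₁ m ((N : ℝ) / m) ∂poissonMeasure r - (r : ℝ) ^ α / m ^ α| ≤
      10 * (r : ℝ) ^ (α - 1) / m ^ α := by
  have hr' : (0 : ℝ) < r := lt_of_lt_of_le one_pos (by exact_mod_cast hr)
  set a := m * threshold c₁ m / 2 with ha
  have ha0 : 0 < a := by positivity
  have iU := (PolyGrowth.upperPart hα hα2 hm hΔ).integrable r
  have iN : Integrable (fun N : ℕ => (N : ℝ) ^ α) (poissonMeasure r) :=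
    (PolyGrowth.rpow (by linarith : 0 ≤ α)).integrable r
  have iN1 : Integrable (fun N : ℕ => (N : ℝ) ^ (α - 1)) (poissonMeasure r) :=
    (PolyGrowth.rpow (by linarith : 0 ≤ α - 1)).integrable r
  have i1 := integrable_tail_indicator (r := r) a (a ^ α)
  -- Here 9 = 8 + 1: the lower tail contributes 8 and the term N^{α-1} contributes 1. The bias of
  -- the plug-in itself adds the last 1.
  have h1 : |∫ N, upperPart α c₁ m ((N : ℝ) / m) ∂poissonMeasure r -
      ∫ N, (N : ℝ) ^ α / m ^ α ∂poissonMeasure r| ≤ 9 * (r : ℝ) ^ (α - 1) / m ^ α := by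
    rw [← integral_sub iU (iN.div_const _)]
    refine abs_integral_le_integral_abs.trans ?_
    refine (integral_mono (iU.sub (iN.div_const _)).abs ((i1.add iN1).div_const (m ^ α))
      fun N => abs_upperPart_sub_le hα hα2 hm hΔ N).trans ?_
    simp only [Pi.add_apply]
    rw [integral_div, integral_add i1 iN1, integral_tail_indicator]
    gcongr
    have h2 : (poissonMeasure r).real {n : ℕ | (n : ℝ) ≤ a} * a ^ α ≤ 8 * (r : ℝ) ^ (α - 1) := by
      calc _ ≤ 8 / r * (r : ℝ) ^ α := by
            gcongr
            · exact lower_tail_mul_le hr (by linarith)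
            · linarith
        _ = _ := by rw [Real.rpow_sub_one hr'.ne']; ring
    have h3 := integral_rpow_poisson_le_rpow r (a := α - 1) (by linarith) (by linarith)
    linarith
  have h2 : |∫ N, (N : ℝ) ^ α / m ^ α ∂poissonMeasure r - (r : ℝ) ^ α / m ^ α| ≤
      (r : ℝ) ^ (α - 1) / m ^ α := by
    rw [integral_div, ← sub_div, abs_div, abs_of_nonneg (by positivity : 0 ≤ m ^ α)]
    gcongr
    have h3 := le_integral_rpow_poisson r hα.le
    have h4 := integral_rpow_poisson_sub_le r hα.le (by linarith) (by exact_mod_cast hr')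
    rw [abs_of_nonneg (by linarith)]
    linarith
  refine (abs_sub_le _ _ _).trans ((add_le_add h1 h2).trans_eq ?_)
  ring

theorem integral_upperPart_sub_sq_le (hα : 1 < α) (hα2 : α < 3 / 2) (hm : 0 < m)
    (hΔ : 0 < threshold c₁ m) (hr : 1 ≤ r) (hrΔ : m * threshold c₁ m ≤ r) :
    ∫ N, (upperPart α c₁ m ((N : ℝ) / m) - (r : ℝ) ^ α / m ^ α) ^ 2 ∂poissonMeasure r ≤
      44 * (r : ℝ) ^ (2 * α - 1) / (m ^ α) ^ 2 := by
  have hr1 : (1 : ℝ) ≤ r := by exact_mod_cast hr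
  have hr' : (0 : ℝ) < r := by linarith
  set a := m * threshold c₁ m / 2 with ha
  have ha0 : 0 < a := by positivity
  have pU := PolyGrowth.upperPart (α := α) (c₁ := c₁) hα hα2 hm hΔ
  have pN : PolyGrowth fun N : ℕ => (N : ℝ) ^ α := PolyGrowth.rpow (by linarith : 0 ≤ α)
  have pN2 : PolyGrowth fun N : ℕ => (N : ℝ) ^ (2 * α) := PolyGrowth.rpow (by linarith)
  have pN1 : PolyGrowth fun N : ℕ => (N : ℝ) ^ (2 * (α - 1)) := PolyGrowth.rpow (by linarith)
  have i1 := integrable_tail_indicator (r := r) a ((a ^ α) ^ 2)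
  have iM : Integrable (fun N : ℕ => ((N : ℝ) ^ α - (r : ℝ) ^ α) ^ 2) (poissonMeasure r) :=
    ((pN.sub (PolyGrowth.const _)).pow 2).integrable r
  have i12 : Integrable (fun N : ℕ => {n : ℕ | (n : ℝ) ≤ a}.indicator (fun _ => (a ^ α) ^ 2) N +
      (N : ℝ) ^ (2 * (α - 1))) (poissonMeasure r) := i1.add (pN1.integrable r)
  -- The constant 44 is 4(8 + 1) + 2·4: tail, correction, and fluctuation of N^α.
  have hpt : ∀ N : ℕ, (upperPart α c₁ m ((N : ℝ) / m) - (r : ℝ) ^ α / m ^ α) ^ 2 ≤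
      (4 * ({n : ℕ | (n : ℝ) ≤ a}.indicator (fun _ => (a ^ α) ^ 2) N + (N : ℝ) ^ (2 * (α - 1)))
        + 2 * ((N : ℝ) ^ α - (r : ℝ) ^ α) ^ 2) / (m ^ α) ^ 2 := by
    intro N
    have h1 := abs_upperPart_sub_le (c₁ := c₁) hα hα2 hm hΔ N
    rw [← ha] at h1
    set u := upperPart α c₁ m ((N : ℝ) / m)
    have h2 : (u - (N : ℝ) ^ α / m ^ α) ^ 2 ≤ 2 * ({n : ℕ | (n : ℝ) ≤ a}.indicator
        (fun _ => (a ^ α) ^ 2) N + (N : ℝ) ^ (2 * (α - 1))) / (m ^ α) ^ 2 := by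
      rw [← sq_abs]
      refine (pow_le_pow_left₀ (abs_nonneg _) h1 2).trans ?_
      rw [div_pow, ← sq_rpow_natCast]
      gcongr
      have h3 : {n : ℕ | (n : ℝ) ≤ a}.indicator (fun _ => (a ^ α) ^ 2) N =
          ({n : ℕ | (n : ℝ) ≤ a}.indicator (fun _ => a ^ α) N) ^ 2 := by
        by_cases hN : N ∈ {n : ℕ | (n : ℝ) ≤ a}
        · rw [Set.indicator_of_mem hN, Set.indicator_of_mem hN]
        · rw [Set.indicator_of_notMem hN, Set.indicator_of_notMem hN]
          norm_num
      rw [h3]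
      exact add_sq_le
    have h4 : (u - (r : ℝ) ^ α / m ^ α) ^ 2 ≤ 2 * (u - (N : ℝ) ^ α / m ^ α) ^ 2 +
        2 * (((N : ℝ) ^ α - (r : ℝ) ^ α) ^ 2 / (m ^ α) ^ 2) := by
      rw [← div_pow, sub_div]
      nlinarith [sq_nonneg ((u - (N : ℝ) ^ α / m ^ α) -
        ((N : ℝ) ^ α / m ^ α - (r : ℝ) ^ α / m ^ α))]
    refine h4.trans ((add_le_add_left (mul_le_mul_of_nonneg_left h2 zero_le_two) _).trans_eq ?_)
    ring
  refine (integral_mono (((pU.sub (PolyGrowth.const _)).pow 2).integrable r)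
    (((i12.const_mul 4).add (iM.const_mul 2)).div_const _) hpt).trans ?_
  simp only [Pi.add_apply]
  rw [integral_div, integral_add (i12.const_mul 4) (iM.const_mul 2),
    integral_const_mul, integral_const_mul, integral_add i1 (pN1.integrable r), integral_tail_indicator]
  have hsq : ∀ b : ℝ, ((r : ℝ) ^ b) ^ 2 = (r : ℝ) ^ (2 * b) := fun b => by
    rw [← Real.rpow_natCast, ← Real.rpow_mul hr'.le, mul_comm]
    norm_num
  have hA : (poissonMeasure r).real {n : ℕ | (n : ℝ) ≤ a} * (a ^ α) ^ 2 ≤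
      8 * (r : ℝ) ^ (2 * α - 1) := by
    calc _ ≤ 8 / r * ((r : ℝ) ^ α) ^ 2 := by
          gcongr
          · exact lower_tail_mul_le hr (by linarith)
          · linarith
      _ = _ := by rw [Real.rpow_sub_one hr'.ne', hsq]; ring
  have hB : ∫ N, (N : ℝ) ^ (2 * (α - 1)) ∂poissonMeasure r ≤ (r : ℝ) ^ (2 * α - 1) :=
    (integral_rpow_poisson_le_rpow r (by linarith) (by linarith)).trans
      (Real.rpow_le_rpow_of_exponent_le hr1 (by linarith))
  -- Expand the square: the upper bound on the moment of order 2α and the Jensen lower bound on that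
  -- of order α make the leading r^{2α} cancel.
  have hC : ∫ N, ((N : ℝ) ^ α - (r : ℝ) ^ α) ^ 2 ∂poissonMeasure r ≤
      4 * (r : ℝ) ^ (2 * α - 1) := by
    have e : ∀ N : ℕ, ((N : ℝ) ^ α - (r : ℝ) ^ α) ^ 2 =
        (N : ℝ) ^ (2 * α) - 2 * (r : ℝ) ^ α * (N : ℝ) ^ α + (r : ℝ) ^ (2 * α) := by
      intro N
      rw [← hsq, ← sq_rpow_natCast]
      ring
    have i3 : Integrable (fun N : ℕ => (N : ℝ) ^ (2 * α) - 2 * (r : ℝ) ^ α * (N : ℝ) ^ α)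
        (poissonMeasure r) := (pN2.integrable r).sub ((pN.integrable r).const_mul _)
    simp only [e]
    rw [integral_add i3 (integrable_const _),
      integral_sub (pN2.integrable r) ((pN.integrable r).const_mul _), integral_const_mul]
    have h1 := integral_rpow_poisson_sub_le' r (a := 2 * α) (by linarith) (by linarith) hr
    have h2 := mul_le_mul_of_nonneg_left (le_integral_rpow_poisson r hα.le)
      (by positivity : 0 ≤ 2 * (r : ℝ) ^ α)
    have h3 : 2 * (r : ℝ) ^ α * (r : ℝ) ^ α = 2 * (r : ℝ) ^ (2 * α) := by rw [← hsq]; ring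
    simp only [integral_const, probReal_univ, one_smul]
    linarith
  gcongr
  linarith

end LargeProbability

/-! ### The estimator for small probabilities -/

theorem cast_descFactorial_eq_prod (N k : ℕ) :
    (N.descFactorial k : ℝ) = ∏ r ∈ Finset.range k, ((N : ℝ) - r) := by
  induction k with
  | zero => simp
  | succ k ih =>
    rw [Finset.prod_range_succ, ← ih, Nat.descFactorial_succ, Nat.cast_mul]
    rcases le_or_gt k N with h | h
    · rw [Nat.cast_sub h, mul_comm]
    · rw [Nat.descFactorial_of_lt h]
      simp

/-- At x = N/m the products become falling factorials, whose Poisson means are exact powers. -/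
theorem lowerPoly_natCast_div {α c₁ c₂ m : ℝ} (hm : 0 < m) (hΔ : 0 < threshold c₁ m) (N : ℕ) :
    lowerPoly α c₁ c₂ m ((N : ℝ) / m) = (4 * threshold c₁ m) ^ α *
      ∑ k ∈ Finset.Icc 1 (approxDegree c₂ m),
        (bestApprox (fun u => u ^ α) (approxDegree c₂ m)).coeff k *
          ((N.descFactorial k : ℝ) / (4 * threshold c₁ m * m) ^ k) := by
  rw [lowerPoly, Finset.mul_sum]
  refine Finset.sum_congr rfl fun k _ => ?_
  have h1 : ∏ r ∈ Finset.range k, ((N : ℝ) / m - (r : ℝ) / m) = N.descFactorial k / m ^ k := by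
    simp only [← sub_div, Finset.prod_div_distrib, Finset.prod_const, Finset.card_range]
    rw [cast_descFactorial_eq_prod]
  rw [h1, Real.rpow_add (by positivity), Real.rpow_neg (by positivity), Real.rpow_natCast,
    mul_pow _ m]
  field_simp

theorem PolyGrowth.lowerPoly (α c₁ c₂ m : ℝ) :
    PolyGrowth fun N => lowerPoly α c₁ c₂ m ((N : ℝ) / m) := by
  unfold PowerSumEstimation.lowerPoly
  refine PolyGrowth.sum _ fun k _ => (PolyGrowth.const _).mul (PolyGrowth.prod _ fun r _ => ?_)
  simp only [div_eq_mul_inv]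
  exact (PolyGrowth.natCast.mul (PolyGrowth.const _)).sub (PolyGrowth.const _)

theorem abs_lowerPart_le (α c₁ c₂ m x : ℝ) :
    |lowerPart α c₁ c₂ m x| ≤ |lowerPoly α c₁ c₂ m x| := by
  rw [lowerPart]
  rcases le_total (lowerPoly α c₁ c₂ m x) 1 with h | h
  · rw [min_eq_left h]
  · rw [min_eq_right h, abs_one]
    exact h.trans (le_abs_self _)

/-- The cap matters only where the polynomial s exceeds 1, and there s - 1 ≤ s². Its cost in bias is
therefore at most the second moment of the polynomial. -/
theorem abs_lowerPart_sub_le (α c₁ c₂ m x : ℝ) :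
    |lowerPart α c₁ c₂ m x - lowerPoly α c₁ c₂ m x| ≤ lowerPoly α c₁ c₂ m x ^ 2 := by
  rw [lowerPart]
  rcases le_total (lowerPoly α c₁ c₂ m x) 1 with h | h
  · rw [min_eq_left h, sub_self, abs_zero]
    positivity
  · rw [min_eq_right h, abs_sub_comm, abs_of_nonneg (by linarith)]
    nlinarith

theorem PolyGrowth.lowerPart (α c₁ c₂ m : ℝ) :
    PolyGrowth fun N => lowerPart α c₁ c₂ m ((N : ℝ) / m) :=
  (PolyGrowth.lowerPoly α c₁ c₂ m).mono fun _ => abs_lowerPart_le _ _ _ _ _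

/-! ### Mean and second moment of the polynomial estimator. -/

section SmallProbability

variable {α c₁ c₂ m : ℝ}

/-- Unbiasedness for the rescaled polynomial; Q(0) is subtracted because the sum starts at k = 1. -/
theorem integral_lowerPoly (hm : 0 < m) (hΔ : 0 < threshold c₁ m) (hα : 0 < α) (r : ℝ≥0) :
    ∫ N, lowerPoly α c₁ c₂ m ((N : ℝ) / m) ∂poissonMeasure r = (4 * threshold c₁ m) ^ α *
      ((bestApprox (fun u => u ^ α) (approxDegree c₂ m)).eval (r / (4 * threshold c₁ m * m)) -
        (bestApprox (fun u => u ^ α) (approxDegree c₂ m)).eval 0) := by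
  simp only [lowerPoly_natCast_div hm hΔ]
  rw [integral_const_mul, integral_finsetSum _ fun k _ =>
    (((PolyGrowth.descFactorial k).integrable r).div_const _).const_mul _]
  congr 1
  set K := approxDegree c₂ m
  set Q := bestApprox (fun u => u ^ α) K
  have hQ : Q.natDegree < K + 1 := Nat.lt_succ_of_le (isBestApprox_rpow hα K).1
  rw [Polynomial.eval_eq_sum_range' hQ, Polynomial.eval_eq_sum_range' hQ, ← Finset.sum_sub_distrib,
    Finset.sum_range_succ']
  simp only [pow_zero, sub_self, add_zero]
  rw [Finset.range_eq_Ico, Finset.sum_Ico_add' (fun k => Q.coeff k * (r / (4 * threshold c₁ m * m)) ^ k -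
    Q.coeff k * 0 ^ k) 0 K 1]
  refine Finset.sum_congr (by ext k; simp) fun k hk => ?_
  rw [Finset.mem_Ico] at hk
  rw [integral_const_mul, integral_div, integral_descFactorial_poisson, zero_pow (by omega),
    div_pow]
  ring

/-- Cauchy–Schwarz with weights |g_k|: the coefficient sum enters twice, so (2·6^K)² = 4·36^K. `G`
bounds the normalized second factorial moments uniformly in k. -/
theorem integral_lowerPoly_sq_le (hm : 0 < m) (hΔ : 0 < threshold c₁ m) (hα : 0 < α) (r : ℝ≥0)
    {G : ℝ} (hG0 : 0 ≤ G) (hG : ∀ k, 1 ≤ k → k ≤ approxDegree c₂ m →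
      (r / (4 * threshold c₁ m * m)) ^ k * (r / (4 * threshold c₁ m * m) +
        k / (4 * threshold c₁ m * m)) ^ k ≤ G) :
    ∫ N, lowerPoly α c₁ c₂ m ((N : ℝ) / m) ^ 2 ∂poissonMeasure r ≤
      ((4 * threshold c₁ m) ^ α) ^ 2 * (4 * 36 ^ approxDegree c₂ m * G) := by
  set K := approxDegree c₂ m with hK
  set M := 4 * threshold c₁ m * m with hM
  have hM0 : 0 < M := by positivity
  set Q := bestApprox (fun u => u ^ α) K with hQ
  have hA : ∑ k ∈ Finset.Icc 1 K, |Q.coeff k| ≤ 2 * 6 ^ K :=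
    (Finset.sum_le_sum_of_subset_of_nonneg (fun k hk => by
      rw [Finset.mem_Icc] at hk
      rw [Finset.mem_range]
      omega) fun _ _ _ => abs_nonneg _).trans (sum_abs_coeff_bestApprox_le hα K)
  have hA0 : 0 ≤ ∑ k ∈ Finset.Icc 1 K, |Q.coeff k| := Finset.sum_nonneg fun _ _ => abs_nonneg _
  have hpt : ∀ N : ℕ, lowerPoly α c₁ c₂ m ((N : ℝ) / m) ^ 2 ≤ ((4 * threshold c₁ m) ^ α) ^ 2 *
      ((2 * 6 ^ K) * ∑ k ∈ Finset.Icc 1 K,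
        |Q.coeff k| * ((N.descFactorial k : ℝ) / M ^ k) ^ 2) := by
    intro N
    rw [lowerPoly_natCast_div hm hΔ, mul_pow]
    gcongr
    refine (Finset.sum_sq_le_sum_mul_sum_of_sq_le_mul _ (fun k _ => abs_nonneg (Q.coeff k))
      (fun k _ => mul_nonneg (abs_nonneg (Q.coeff k))
        (sq_nonneg ((N.descFactorial k : ℝ) / M ^ k))) fun k _ => ?_).trans ?_
    · rw [mul_pow, ← sq_abs (Q.coeff k)]
      exact le_of_eq (by ring)
    · gcongr
  have hint : ∀ k, Integrable (fun N : ℕ => |Q.coeff k| * ((N.descFactorial k : ℝ) / M ^ k) ^ 2)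
      (poissonMeasure r) := fun k =>
    PolyGrowth.integrable ((PolyGrowth.const _).mul
      (((PolyGrowth.descFactorial k).mul (PolyGrowth.const (M ^ k)⁻¹)).pow 2)) r
  refine (integral_mono (((PolyGrowth.lowerPoly α c₁ c₂ m).pow 2).integrable r)
    (((integrable_finsetSum _ fun k _ => hint k).const_mul _).const_mul _) hpt).trans ?_
  rw [integral_const_mul, integral_const_mul, integral_finsetSum _ fun k _ => hint k]
  refine mul_le_mul_of_nonneg_left ?_ (by positivity)
  have hk : ∀ k ∈ Finset.Icc 1 K, ∫ N : ℕ, |Q.coeff k| * ((N.descFactorial k : ℝ) / M ^ k) ^ 2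
      ∂poissonMeasure r ≤ |Q.coeff k| * G := by
    intro k hk
    rw [Finset.mem_Icc] at hk
    rw [integral_const_mul]
    simp only [div_pow]
    rw [integral_div]
    gcongr
    refine le_trans ?_ (hG k hk.1 hk.2)
    rw [← add_div, div_pow, div_pow, ← mul_div_mul_comm, ← sq]
    gcongr
    exact integral_descFactorial_sq_poisson_le r k
  calc 2 * 6 ^ K * ∑ k ∈ Finset.Icc 1 K, ∫ N : ℕ, |Q.coeff k| *
        ((N.descFactorial k : ℝ) / M ^ k) ^ 2 ∂poissonMeasure r
      ≤ 2 * 6 ^ K * ∑ k ∈ Finset.Icc 1 K, |Q.coeff k| * G := by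
        gcongr with k hk'
        exact hk k hk'
    _ = 2 * 6 ^ K * ((∑ k ∈ Finset.Icc 1 K, |Q.coeff k|) * G) := by rw [Finset.sum_mul]
    _ ≤ 2 * 6 ^ K * ((2 * 6 ^ K) * G) := by gcongr
    _ = 4 * 36 ^ K * G := by
      rw [show (36 : ℝ) = 6 * 6 by norm_num, mul_pow]
      ring

/-- With y = r/(4Δm) ≤ 1 and k ≤ K ≤ 4Δm, the moment y^k (y + k/(4Δm))^k is at most y·2^K. Keeping
one factor y preserves linearity in p, and 72 = 36·2. -/
theorem integral_lowerPoly_sq_le_of_le (hm : 0 < m) (hΔ : 0 < threshold c₁ m) (hα : 0 < α)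
    (hK : (approxDegree c₂ m : ℝ) ≤ 4 * threshold c₁ m * m) (r : ℝ≥0)
    (hr : r ≤ 4 * threshold c₁ m * m) :
    ∫ N, lowerPoly α c₁ c₂ m ((N : ℝ) / m) ^ 2 ∂poissonMeasure r ≤
      ((4 * threshold c₁ m) ^ α) ^ 2 *
        (4 * 72 ^ approxDegree c₂ m * (r / (4 * threshold c₁ m * m))) := by
  have hM0 : 0 < 4 * threshold c₁ m * m := by positivity
  have hy : (r : ℝ) / (4 * threshold c₁ m * m) ≤ 1 := by rwa [div_le_one hM0]
  have hy0 : 0 ≤ (r : ℝ) / (4 * threshold c₁ m * m) := by positivity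
  refine (integral_lowerPoly_sq_le hm hΔ hα r
    (G := r / (4 * threshold c₁ m * m) * 2 ^ approxDegree c₂ m) (by positivity) fun k hk1 hk => ?_).trans_eq ?_
  · have hkM : (k : ℝ) / (4 * threshold c₁ m * m) ≤ 1 := by
      rw [div_le_one hM0]
      exact le_trans (by exact_mod_cast hk) hK
    have hkM0 : 0 ≤ (k : ℝ) / (4 * threshold c₁ m * m) := by positivity
    gcongr
    · exact pow_le_of_le_one hy0 hy (by omega)
    · calc _ ≤ (2 : ℝ) ^ k := by gcongr; linarith
        _ ≤ _ := by gcongr; norm_num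
  · rw [show (72 : ℝ) = 36 * 2 by norm_num, mul_pow (36 : ℝ)]
    ring

theorem integral_lowerPoly_sq_le_of_ge (hm : 0 < m) (hΔ : 0 < threshold c₁ m) (hα : 0 < α)
    (hK : (approxDegree c₂ m : ℝ) ≤ 4 * threshold c₁ m * m) (r : ℝ≥0)
    (hr : 4 * threshold c₁ m * m ≤ r) :
    ∫ N, lowerPoly α c₁ c₂ m ((N : ℝ) / m) ^ 2 ∂poissonMeasure r ≤
      ((4 * threshold c₁ m) ^ α) ^ 2 * (4 * 72 ^ approxDegree c₂ m *
        (r / (4 * threshold c₁ m * m)) ^ (2 * approxDegree c₂ m)) := by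
  have hM0 : 0 < 4 * threshold c₁ m * m := by positivity
  have hy : 1 ≤ (r : ℝ) / (4 * threshold c₁ m * m) := by rwa [one_le_div hM0]
  refine (integral_lowerPoly_sq_le hm hΔ hα r
    (G := (r / (4 * threshold c₁ m * m)) ^ (2 * approxDegree c₂ m) * 2 ^ approxDegree c₂ m)
    (by positivity) fun k hk1 hk => ?_).trans_eq ?_
  · set y := (r : ℝ) / (4 * threshold c₁ m * m)
    have hkM : (k : ℝ) / (4 * threshold c₁ m * m) ≤ 1 := by
      rw [div_le_one hM0]
      exact le_trans (by exact_mod_cast hk) hK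
    have hkM0 : 0 ≤ (k : ℝ) / (4 * threshold c₁ m * m) := by positivity
    calc y ^ k * (y + k / (4 * threshold c₁ m * m)) ^ k ≤ y ^ k * (2 * y) ^ k := by
          gcongr; linarith
      _ = y ^ (2 * k) * 2 ^ k := by rw [mul_pow, two_mul, pow_add]; ring
      _ ≤ _ := by gcongr; norm_num
  · rw [show (72 : ℝ) = 36 * 2 by norm_num, mul_pow (36 : ℝ)]
    ring

theorem abs_integral_lowerPart_sub_le (r : ℝ≥0) (c : ℝ) :
    |∫ N, lowerPart α c₁ c₂ m ((N : ℝ) / m) ∂poissonMeasure r - c| ≤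
      |∫ N, lowerPoly α c₁ c₂ m ((N : ℝ) / m) ∂poissonMeasure r - c| +
        ∫ N, lowerPoly α c₁ c₂ m ((N : ℝ) / m) ^ 2 ∂poissonMeasure r := by
  have iL := (PolyGrowth.lowerPart α c₁ c₂ m).integrable r
  have iS := (PolyGrowth.lowerPoly α c₁ c₂ m).integrable r
  have h : |∫ N, lowerPart α c₁ c₂ m ((N : ℝ) / m) ∂poissonMeasure r -
      ∫ N, lowerPoly α c₁ c₂ m ((N : ℝ) / m) ∂poissonMeasure r| ≤
      ∫ N, lowerPoly α c₁ c₂ m ((N : ℝ) / m) ^ 2 ∂poissonMeasure r := by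
    rw [← integral_sub iL iS]
    exact abs_integral_le_integral_abs.trans (integral_mono (iL.sub iS).abs
      (((PolyGrowth.lowerPoly α c₁ c₂ m).pow 2).integrable r)
      fun N => abs_lowerPart_sub_le _ _ _ _ _)
  have h2 := abs_sub_le (∫ N, lowerPart α c₁ c₂ m ((N : ℝ) / m) ∂poissonMeasure r)
    (∫ N, lowerPoly α c₁ c₂ m ((N : ℝ) / m) ∂poissonMeasure r) c
  linarith

theorem integral_sub_sq_le_two_mul {f g : ℕ → ℝ} (hf : PolyGrowth f) (hg : PolyGrowth g)
    (hfg : ∀ n, |f n| ≤ |g n|) (r : ℝ≥0) (c : ℝ) :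
    ∫ N, (f N - c) ^ 2 ∂poissonMeasure r ≤ 2 * ∫ N, g N ^ 2 ∂poissonMeasure r + 2 * c ^ 2 := by
  have ig := (hg.pow 2).integrable r
  refine (integral_mono (((hf.sub (PolyGrowth.const c)).pow 2).integrable r)
    ((ig.const_mul 2).add (integrable_const (2 * c ^ 2))) fun N => ?_).trans_eq ?_
  · have h := sq_le_sq.2 (hfg N)
    simp only [Pi.add_apply]
    nlinarith [sq_nonneg (f N + c)]
  · simp only [Pi.add_apply]
    rw [integral_add (ig.const_mul 2) (integrable_const _), integral_const_mul]
    simp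

end SmallProbability

/-! ### Mixing the two regimes -/

theorem integral_ite_prod {f g : ℕ → ℝ} (hf : PolyGrowth f) (hg : PolyGrowth g) (r : ℝ≥0)
    (A : Set ℕ) [DecidablePred (· ∈ A)] :
    Integrable (fun z : ℕ × ℕ => if z.2 ∈ A then f z.1 else g z.1)
      ((poissonMeasure r).prod (poissonMeasure r)) ∧
    ∫ z, (if z.2 ∈ A then f z.1 else g z.1) ∂(poissonMeasure r).prod (poissonMeasure r) =
      (∫ N, f N ∂poissonMeasure r) * (poissonMeasure r).real A +
        (∫ N, g N ∂poissonMeasure r) * (poissonMeasure r).real Aᶜ := by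
  have e : (fun z : ℕ × ℕ => if z.2 ∈ A then f z.1 else g z.1) = fun z =>
      f z.1 * A.indicator 1 z.2 + g z.1 * Aᶜ.indicator 1 z.2 := by
    ext z
    by_cases hz : z.2 ∈ A <;> simp [hz]
  have iA : ∀ B : Set ℕ, Integrable (B.indicator (1 : ℕ → ℝ)) (poissonMeasure r) := fun B =>
    (integrable_const (1 : ℝ)).indicator MeasurableSet.of_discrete
  have i1 := (hf.integrable r).mul_prod (iA A)
  have i2 := (hg.integrable r).mul_prod (iA Aᶜ)
  rw [e]
  refine ⟨i1.add i2, ?_⟩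
  rw [integral_add i1 i2, integral_prod_mul, integral_prod_mul,
    integral_indicator_one MeasurableSet.of_discrete,
    integral_indicator_one MeasurableSet.of_discrete]

section Mixture

variable {α c₁ c₂ m : ℝ}

/-- The set of second counts for which the small-probability estimator is used. -/
def lowCounts (c₁ m : ℝ) : Set ℕ := {n | (n : ℝ) ≤ 2 * (m * threshold c₁ m)}

theorem symbolEstimator_eq (hm : 0 < m) (z : ℕ × ℕ) [DecidablePred (· ∈ lowCounts c₁ m)] :
    symbolEstimator α c₁ c₂ m z = if z.2 ∈ lowCounts c₁ m then
      lowerPart α c₁ c₂ m ((z.1 : ℝ) / m) else upperPart α c₁ m ((z.1 : ℝ) / m) := by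
  have h : (z.2 : ℝ) / m ≤ 2 * threshold c₁ m ↔ z.2 ∈ lowCounts c₁ m := by
    rw [lowCounts, Set.mem_ofPred_eq, div_le_iff₀ hm]
    ring_nf
  simp only [symbolEstimator, h]

open scoped Classical in
theorem integral_symbolEstimator_sub_sq (hα : 1 < α) (hα2 : α < 3 / 2) (hm : 0 < m)
    (hΔ : 0 < threshold c₁ m) (r : ℝ≥0) (c : ℝ) :
    Integrable (fun z => (symbolEstimator α c₁ c₂ m z - c) ^ 2)
      ((poissonMeasure r).prod (poissonMeasure r)) ∧
    ∫ z, (symbolEstimator α c₁ c₂ m z - c) ^ 2 ∂(poissonMeasure r).prod (poissonMeasure r) =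
      (∫ N, (lowerPart α c₁ c₂ m ((N : ℝ) / m) - c) ^ 2 ∂poissonMeasure r) *
        (poissonMeasure r).real (lowCounts c₁ m) +
      (∫ N, (upperPart α c₁ m ((N : ℝ) / m) - c) ^ 2 ∂poissonMeasure r) *
        (poissonMeasure r).real (lowCounts c₁ m)ᶜ := by
  have h := integral_ite_prod
    (((PolyGrowth.lowerPart α c₁ c₂ m).sub (PolyGrowth.const c)).pow 2)
    (((PolyGrowth.upperPart hα hα2 hm hΔ).sub (PolyGrowth.const c)).pow 2) r (lowCounts c₁ m)
  have e : (fun z : ℕ × ℕ => (symbolEstimator α c₁ c₂ m z - c) ^ 2) = fun z =>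
      if z.2 ∈ lowCounts c₁ m then (lowerPart α c₁ c₂ m ((z.1 : ℝ) / m) - c) ^ 2
        else (upperPart α c₁ m ((z.1 : ℝ) / m) - c) ^ 2 := by
    ext z
    rw [symbolEstimator_eq hm]
    split_ifs <;> rfl
  rw [e]
  exact h

open scoped Classical in
theorem integral_symbolEstimator_sub (hα : 1 < α) (hα2 : α < 3 / 2) (hm : 0 < m)
    (hΔ : 0 < threshold c₁ m) (r : ℝ≥0) (c : ℝ) :
    ∫ z, symbolEstimator α c₁ c₂ m z ∂(poissonMeasure r).prod (poissonMeasure r) - c =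
      (∫ N, lowerPart α c₁ c₂ m ((N : ℝ) / m) ∂poissonMeasure r - c) *
        (poissonMeasure r).real (lowCounts c₁ m) +
      (∫ N, upperPart α c₁ m ((N : ℝ) / m) ∂poissonMeasure r - c) *
        (poissonMeasure r).real (lowCounts c₁ m)ᶜ := by
  have h := (integral_ite_prod (PolyGrowth.lowerPart α c₁ c₂ m)
    (PolyGrowth.upperPart hα hα2 hm hΔ) r (lowCounts c₁ m)).2
  simp only [symbolEstimator_eq hm]
  rw [h, probReal_compl_eq_one_sub MeasurableSet.of_discrete]
  ring

theorem memLp_symbolEstimator (hα : 1 < α) (hα2 : α < 3 / 2) (hm : 0 < m)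
    (hΔ : 0 < threshold c₁ m) (r : ℝ≥0) :
    MemLp (symbolEstimator α c₁ c₂ m) 2 ((poissonMeasure r).prod (poissonMeasure r)) := by
  rw [memLp_two_iff_integrable_sq .of_discrete]
  simpa using (integral_symbolEstimator_sub_sq (c₂ := c₂) hα hα2 hm hΔ r 0).1

end Mixture

/-! ### Asymptotics of the tuning parameters -/

/-- The per-symbol rate `(m ln m) ^ (-(α - 1))`. -/
def rate (α m : ℝ) : ℝ := (m * Real.log m) ^ (-(α - 1))

/-- The effective sample size `m` is large enough for the tuning parameters to be in their
asymptotic regime. -/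
structure LargeSample (α c₁ c₂ m : ℝ) : Prop where
  one_le : 1 ≤ m
  one_le_log : 1 ≤ Real.log m
  one_le_degree : 1 ≤ approxDegree c₂ m
  le_degree : c₂ / 2 * Real.log m ≤ approxDegree c₂ m
  -- This controls the second moment of the polynomial estimator for p ≤ 4Δ.
  pow_mul_threshold_le : 72 ^ approxDegree c₂ m * (4 * threshold c₁ m) ^ (2 * α - 1) ≤ rate α m ^ 2
  -- This absorbs the mean squared error of `upperPart` for p ≥ Δ and the exponentially small
  -- remainders for p ≥ 4Δ.
  inv_le : 1 / m ≤ rate α m ^ 2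
  threshold_le : 4 * threshold c₁ m ≤ 1

/-- 72 < 2^7, so the power is at most m^{7 c₂ ln 2}, and 10 c₂ ln 2 < 2α - 2 < 1. -/
theorem pow_approxDegree_le {α c₂ m : ℝ} (hα₂ : α < 3 / 2) (hc₂ : 0 < c₂)
    (hc₂' : 10 * c₂ * Real.log 2 < 2 * α - 2) (hm : 0 < m) (hl : 0 ≤ Real.log m) :
    (72 : ℝ) ^ approxDegree c₂ m ≤ m ^ (7 / 10 : ℝ) := by
  have h1 : (approxDegree c₂ m : ℝ) ≤ c₂ * Real.log m := Nat.floor_le (by positivity)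
  calc (72 : ℝ) ^ approxDegree c₂ m ≤ (2 ^ 7) ^ approxDegree c₂ m := by
        gcongr
        norm_num
    _ = Real.exp (Real.log 2 * (7 * approxDegree c₂ m)) := by
        rw [← pow_mul, ← Real.rpow_natCast, Real.rpow_def_of_pos two_pos]
        push_cast
        rfl
    _ ≤ Real.exp (Real.log m * (7 / 10)) := by
        rw [Real.exp_le_exp]
        have h2 : 0 < Real.log 2 := Real.log_pos one_lt_two
        have h3 : Real.log 2 * (7 * approxDegree c₂ m) ≤ Real.log 2 * (7 * (c₂ * Real.log m)) := by
          gcongr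
        have h4 : c₂ * Real.log 2 ≤ 1 / 10 := by linarith
        have h5 := mul_le_mul_of_nonneg_right h4 hl
        linarith
    _ = _ := by rw [Real.rpow_def_of_pos hm]

theorem rate_sq {α m : ℝ} (hm : 0 < m) (hl : 0 < Real.log m) :
    rate α m ^ 2 = m ^ (-(2 * (α - 1))) * Real.log m ^ (-(2 * (α - 1))) := by
  rw [rate, ← Real.rpow_natCast, ← Real.rpow_mul (by positivity), Real.mul_rpow hm.le hl.le]
  push_cast
  ring_nf

theorem eventually_largeSample {α c₁ c₂ : ℝ} (hα₁ : 1 < α) (hα₂ : α < 3 / 2)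
    (hc₁ : 16 * α < c₁) (hc₂ : 0 < c₂) (hc₂' : 10 * c₂ * Real.log 2 < 2 * α - 2) :
    ∀ᶠ m : ℝ in atTop, LargeSample α c₁ c₂ m := by
  have hc₁0 : 0 < c₁ := by linarith
  set D : ℝ := (4 * c₁) ^ (2 * α - 1) with hD
  have hD0 : 0 < D := by positivity
  -- The exponent 3/10 is the 1 - 7/10 left over after bounding 72^K, and it must beat the
  -- logarithmic factor (ln m)^{4α-3} ≤ (ln m)³.
  have e1 : ∀ᶠ m : ℝ in atTop, ‖Real.log m ^ (3 : ℝ)‖ ≤ D⁻¹ * ‖m ^ (3 / 10 : ℝ)‖ :=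
    (isLittleO_log_rpow_rpow_atTop 3 (by norm_num)).bound (by positivity)
  have e2 : ∀ᶠ m : ℝ in atTop, ‖Real.log m‖ ≤ 1 * ‖m ^ (1 - 2 * (α - 1))‖ :=
    (isLittleO_log_rpow_atTop (by linarith)).bound one_pos
  have e3 : ∀ᶠ m : ℝ in atTop, ‖Real.log m‖ ≤ (4 * c₁)⁻¹ * ‖m ^ (1 : ℝ)‖ :=
    (isLittleO_log_rpow_atTop one_pos).bound (by positivity)
  filter_upwards [e1, e2, e3, eventually_ge_atTop 1,
    Real.tendsto_log_atTop.eventually_ge_atTop 1,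
    Real.tendsto_log_atTop.eventually_ge_atTop (2 / c₂)] with m h1 h2 h3 hm1 hl1 hl2
  have hm0 : 0 < m := by linarith
  have hl0 : 0 < Real.log m := by linarith
  rw [Real.norm_of_nonneg (by positivity), Real.norm_of_nonneg (by positivity),
    inv_mul_eq_div, le_div_iff₀ hD0] at h1
  rw [Real.norm_of_nonneg hl0.le, Real.norm_of_nonneg (by positivity), one_mul] at h2
  rw [Real.norm_of_nonneg hl0.le, Real.norm_of_nonneg (by positivity), Real.rpow_one,
    inv_mul_eq_div, le_div_iff₀ (by positivity)] at h3
  have hx : 2 ≤ c₂ * Real.log m := by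
    rw [div_le_iff₀ hc₂] at hl2
    linarith
  -- Rounding down loses less than 1, which is at most half of c₂ ln m once that is at least 2.
  have hfl : c₂ / 2 * Real.log m ≤ approxDegree c₂ m := by
    have := Nat.lt_floor_add_one (c₂ * Real.log m)
    rw [approxDegree]
    linarith
  refine ⟨hm1, hl1, ?_, hfl, ?_, ?_, ?_⟩
  · exact Nat.le_floor (by push_cast; linarith)
  · have hthr : (4 * threshold c₁ m) ^ (2 * α - 1) =
        D * Real.log m ^ (2 * α - 1) * m ^ (-(2 * α - 1)) := by
      rw [threshold, ← mul_div_assoc, ← mul_assoc, Real.div_rpow (by positivity) hm0.le,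
        Real.mul_rpow (by positivity) hl0.le, Real.rpow_neg hm0.le]
      ring
    have hlog : Real.log m ^ (2 * α - 1) =
        Real.log m ^ (4 * α - 3) * Real.log m ^ (-(2 * (α - 1))) := by
      rw [← Real.rpow_add hl0]
      ring_nf
    have hlog2 : Real.log m ^ (4 * α - 3) ≤ Real.log m ^ (3 : ℝ) :=
      Real.rpow_le_rpow_of_exponent_le hl1 (by linarith)
    have hmm : m ^ (7 / 10 : ℝ) * (m ^ (3 / 10 : ℝ) * m ^ (-(2 * α - 1))) =
        m ^ (-(2 * (α - 1))) := by
      rw [← Real.rpow_add hm0, ← Real.rpow_add hm0]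
      ring_nf
    rw [rate_sq hm0 hl0, hthr, hlog, ← hmm]
    calc 72 ^ approxDegree c₂ m * (D * (Real.log m ^ (4 * α - 3) *
          Real.log m ^ (-(2 * (α - 1)))) * m ^ (-(2 * α - 1)))
        ≤ m ^ (7 / 10 : ℝ) * (D * (Real.log m ^ (3 : ℝ) *
          Real.log m ^ (-(2 * (α - 1)))) * m ^ (-(2 * α - 1))) := by
          gcongr
          exact pow_approxDegree_le hα₂ hc₂ hc₂' hm0 hl0.le
      _ = m ^ (7 / 10 : ℝ) * ((Real.log m ^ (3 : ℝ) * D) *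
          Real.log m ^ (-(2 * (α - 1))) * m ^ (-(2 * α - 1))) := by ring
      _ ≤ m ^ (7 / 10 : ℝ) * (m ^ (3 / 10 : ℝ) *
          Real.log m ^ (-(2 * (α - 1))) * m ^ (-(2 * α - 1))) := by gcongr
      _ = _ := by ring
  · rw [rate_sq hm0 hl0]
    have hlog : Real.log m ^ (2 * (α - 1)) ≤ m ^ (1 - 2 * (α - 1)) := by
      refine le_trans ?_ h2
      conv_rhs => rw [← Real.rpow_one (Real.log m)]
      exact Real.rpow_le_rpow_of_exponent_le hl1 (by linarith)
    have hmm : m ^ (1 - 2 * (α - 1)) = m * m ^ (-(2 * (α - 1))) := by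
      rw [sub_eq_add_neg, Real.rpow_add hm0, Real.rpow_one]
    rw [hmm] at hlog
    rw [div_le_iff₀ hm0, Real.rpow_neg hl0.le]
    have hp : 0 < Real.log m ^ (2 * (α - 1)) := by positivity
    calc (1 : ℝ) = Real.log m ^ (2 * (α - 1)) * (Real.log m ^ (2 * (α - 1)))⁻¹ := by
          field_simp
      _ ≤ m * m ^ (-(2 * (α - 1))) * (Real.log m ^ (2 * (α - 1)))⁻¹ := by gcongr
      _ = _ := by ring
  · rw [threshold, ← mul_div_assoc, div_le_one hm0]
    linarith

/-! ### Single-symbol bounds for each estimator in each range of p. -/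

namespace LargeSample

variable {α c₁ c₂ m : ℝ}

theorem pos (h : LargeSample α c₁ c₂ m) : 0 < m := by linarith [h.one_le]

theorem log_pos (h : LargeSample α c₁ c₂ m) : 0 < Real.log m := by linarith [h.one_le_log]

theorem rate_pos (h : LargeSample α c₁ c₂ m) : 0 < rate α m :=
  Real.rpow_pos_of_pos (mul_pos h.pos h.log_pos) _

theorem rate_le_one (h : LargeSample α c₁ c₂ m) (hα : 1 < α) : rate α m ≤ 1 :=
  Real.rpow_le_one_of_one_le_of_nonpos (one_le_mul_of_one_le_of_one_le h.one_le h.one_le_log)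
    (by linarith)

theorem rate_sq_le (h : LargeSample α c₁ c₂ m) (hα : 1 < α) : rate α m ^ 2 ≤ rate α m :=
  pow_le_of_le_one h.rate_pos.le (h.rate_le_one hα) two_ne_zero

theorem threshold_pos (h : LargeSample α c₁ c₂ m) (hc₁ : 0 < c₁) : 0 < threshold c₁ m :=
  div_pos (mul_pos hc₁ h.log_pos) h.pos

theorem mul_threshold (h : LargeSample α c₁ c₂ m) : m * threshold c₁ m = c₁ * Real.log m :=
  mul_div_cancel₀ _ h.pos.ne'

theorem threshold_rpow_le (h : LargeSample α c₁ c₂ m) (hc₁ : 0 < c₁) :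
    (4 * threshold c₁ m) ^ (2 * α - 1) ≤ rate α m ^ 2 := by
  have := h.threshold_pos hc₁
  exact (le_mul_of_one_le_left (by positivity) (one_le_pow₀ (by norm_num))).trans
    h.pow_mul_threshold_le

/-- Δ^{α-1} exceeds the rate by (ln m)^{2(α-1)}, exactly the gain K^{-2(α-1)} of polynomial
approximation. -/
theorem threshold_rpow_eq (h : LargeSample α c₁ c₂ m) (hc₁ : 0 < c₁) :
    (4 * threshold c₁ m) ^ (α - 1) =
      (4 * c₁) ^ (α - 1) * Real.log m ^ (2 * (α - 1)) * rate α m := by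
  have hl := h.log_pos
  have hm := h.pos
  rw [threshold, rate, ← mul_div_assoc, ← mul_assoc, Real.div_rpow (by positivity) hm.le,
    Real.mul_rpow (by positivity) hl.le, Real.mul_rpow hm.le hl.le, Real.rpow_neg hm.le,
    mul_assoc _ (Real.log m ^ (2 * (α - 1))), mul_left_comm (Real.log m ^ (2 * (α - 1))),
    ← Real.rpow_add hl]
  ring_nf

theorem degree_le (h : LargeSample α c₁ c₂ m) (hc₁ : 1 ≤ c₁) (hc₂ : 0 < c₂) (hc₂' : c₂ ≤ 1) :
    (approxDegree c₂ m : ℝ) ≤ 4 * threshold c₁ m * m := by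
  have hl := h.log_pos
  have h1 : (approxDegree c₂ m : ℝ) ≤ c₂ * Real.log m := Nat.floor_le (by positivity)
  have h2 := h.mul_threshold (c₁ := c₁)
  nlinarith

theorem mul_rpow_eq {p : ℝ} (hp : 0 ≤ p) {a : ℝ} (ha : a ≠ 0) : p * p ^ (a - 1) = p ^ a := by
  rw [← Real.rpow_one_add' hp (by simpa using ha)]
  ring_nf

theorem rpow_sq_le (h : LargeSample α c₁ c₂ m) (hα : 1 < α) (hc₁ : 0 < c₁) {p : ℝ} (hp : 0 ≤ p)
    (hpΔ : p ≤ 4 * threshold c₁ m) : (p ^ α) ^ 2 ≤ p * rate α m ^ 2 := by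
  have e : (p ^ α) ^ 2 = p * p ^ (2 * α - 1) := by
    rw [mul_rpow_eq hp (by linarith), ← Real.rpow_natCast, ← Real.rpow_mul hp, mul_comm]
    norm_num
  rw [e]
  gcongr
  exact (Real.rpow_le_rpow hp hpΔ (by linarith)).trans (h.threshold_rpow_le hc₁)

theorem lowerPoly_sq_small (h : LargeSample α c₁ c₂ m) (hα : 1 < α) (hc₁ : 1 ≤ c₁) (hc₂ : 0 < c₂)
    (hc₂' : c₂ ≤ 1) {r : ℝ≥0} (hr : r / m ≤ 4 * threshold c₁ m) :
    ∫ N, lowerPoly α c₁ c₂ m ((N : ℝ) / m) ^ 2 ∂poissonMeasure r ≤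
      4 * (r / m) * rate α m ^ 2 := by
  have hm := h.pos
  have hΔ := h.threshold_pos (by linarith : 0 < c₁)
  refine (integral_lowerPoly_sq_le_of_le hm hΔ (by linarith) (h.degree_le hc₁ hc₂ hc₂') r
    (by rwa [div_le_iff₀ hm] at hr)).trans ?_
  have e : ((4 * threshold c₁ m) ^ α) ^ 2 =
      4 * threshold c₁ m * (4 * threshold c₁ m) ^ (2 * α - 1) := by
    rw [mul_rpow_eq (by positivity) (by linarith), ← Real.rpow_natCast,
      ← Real.rpow_mul (by positivity), mul_comm α]
    norm_num
  rw [e]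
  calc _ = 4 * (r / m) * (72 ^ approxDegree c₂ m * (4 * threshold c₁ m) ^ (2 * α - 1)) := by
        field_simp
    _ ≤ _ := by
        gcongr
        exact h.pow_mul_threshold_le

/-- With x = p/(4Δ), the approximation error is (4Δ)^α D K^{-2(α-1)} x, and 4Δx = p supplies the
linear factor while the logarithms cancel. The summand 4 pays for the cap at 1. -/
theorem lowerPart_bias_small (h : LargeSample α c₁ c₂ m) (hα : 1 < α) (hc₁ : 1 ≤ c₁)
    (hc₂ : 0 < c₂) (hc₂' : c₂ ≤ 1) {D : ℝ} (hD0 : 0 < D)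
    (hD : ∀ K : ℕ, 1 ≤ K → ∀ x ∈ Set.Icc (0 : ℝ) 1,
      |(bestApprox (fun u => u ^ α) K).eval x - (bestApprox (fun u => u ^ α) K).eval 0 - x ^ α| ≤
        D * (K : ℝ) ^ (-(2 * (α - 1))) * x)
    {r : ℝ≥0} (hr : r / m ≤ 4 * threshold c₁ m) :
    |∫ N, lowerPart α c₁ c₂ m ((N : ℝ) / m) ∂poissonMeasure r - (r / m) ^ α| ≤
      (D * (c₂ / 2) ^ (-(2 * (α - 1))) * (4 * c₁) ^ (α - 1) + 4) * (r / m) * rate α m := by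
  have hm := h.pos
  have hl := h.log_pos
  have hρ := h.rate_pos
  have hΔ := h.threshold_pos (by linarith : 0 < c₁)
  have hp : 0 ≤ (r : ℝ) / m := by positivity
  have h1 := abs_integral_lowerPart_sub_le (α := α) (c₁ := c₁) (c₂ := c₂) (m := m) r ((r / m) ^ α)
  have h2 := h.lowerPoly_sq_small hα hc₁ hc₂ hc₂' hr
  have h3 : 4 * (r / m) * rate α m ^ 2 ≤ 4 * (r / m) * rate α m := by
    gcongr
    exact h.rate_sq_le hα
  have h4 : |∫ N, lowerPoly α c₁ c₂ m ((N : ℝ) / m) ∂poissonMeasure r - (r / m) ^ α| ≤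
      D * (c₂ / 2) ^ (-(2 * (α - 1))) * (4 * c₁) ^ (α - 1) * (r / m) * rate α m := by
    set x : ℝ := r / (4 * threshold c₁ m * m) with hx
    have hxp : (r : ℝ) / m = 4 * threshold c₁ m * x := by rw [hx]; field_simp
    have hx01 : x ∈ Set.Icc (0 : ℝ) 1 := by
      refine ⟨by positivity, ?_⟩
      rw [hx, div_le_one (by positivity)]
      rwa [div_le_iff₀ hm] at hr
    have h5 := hD _ h.one_le_degree x hx01
    rw [integral_lowerPoly hm hΔ (by linarith), ← hx, hxp,
      Real.mul_rpow (by positivity) hx01.1, ← mul_sub, abs_mul,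
      abs_of_nonneg (by positivity : 0 ≤ (4 * threshold c₁ m) ^ α)]
    have h6 : (approxDegree c₂ m : ℝ) ^ (-(2 * (α - 1))) ≤
        (c₂ / 2) ^ (-(2 * (α - 1))) * Real.log m ^ (-(2 * (α - 1))) := by
      rw [← Real.mul_rpow (by positivity) hl.le]
      exact Real.rpow_le_rpow_of_nonpos (by positivity) h.le_degree (by linarith)
    have h7 : (4 * threshold c₁ m) ^ α = 4 * threshold c₁ m *
        ((4 * c₁) ^ (α - 1) * Real.log m ^ (2 * (α - 1)) * rate α m) := by
      rw [← h.threshold_rpow_eq (by linarith), mul_rpow_eq (by positivity) (by linarith)]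
    have h8 : Real.log m ^ (2 * (α - 1)) * Real.log m ^ (-(2 * (α - 1))) = 1 := by
      rw [← Real.rpow_add hl]
      simp
    have hx0 := hx01.1
    calc (4 * threshold c₁ m) ^ α * _
        ≤ (4 * threshold c₁ m) ^ α * (D * ((c₂ / 2) ^ (-(2 * (α - 1))) *
          Real.log m ^ (-(2 * (α - 1)))) * x) := by
          refine mul_le_mul_of_nonneg_left (h5.trans ?_) (by positivity)
          gcongr
      _ = D * (c₂ / 2) ^ (-(2 * (α - 1))) * (4 * c₁) ^ (α - 1) * (4 * threshold c₁ m * x) *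
          rate α m * (Real.log m ^ (2 * (α - 1)) * Real.log m ^ (-(2 * (α - 1)))) := by
          rw [h7]; ring
      _ = _ := by rw [h8, mul_one]
  linarith

theorem lowerPart_sq_small (h : LargeSample α c₁ c₂ m) (hα : 1 < α) (hc₁ : 1 ≤ c₁)
    (hc₂ : 0 < c₂) (hc₂' : c₂ ≤ 1) {r : ℝ≥0} (hr : r / m ≤ 4 * threshold c₁ m) :
    ∫ N, (lowerPart α c₁ c₂ m ((N : ℝ) / m) - (r / m) ^ α) ^ 2 ∂poissonMeasure r ≤
      10 * (r / m) * rate α m ^ 2 := by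
  have hm := h.pos
  have h1 := integral_sub_sq_le_two_mul (PolyGrowth.lowerPart α c₁ c₂ m)
    (PolyGrowth.lowerPoly α c₁ c₂ m) (fun N => abs_lowerPart_le _ _ _ _ _) r ((r / m) ^ α)
  have h2 := h.lowerPoly_sq_small hα hc₁ hc₂ hc₂' hr
  have h3 := h.rpow_sq_le hα (by linarith) (by positivity) hr
  linarith

/-- No tail probability is needed: both second moments are at most p (4Δ)^{2α-1}, since r + 2 ≤ 4Δm.
-/
theorem upperPart_sq_small (h : LargeSample α c₁ c₂ m) (hα : 1 < α) (hα2 : α < 3 / 2)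
    (hc₁ : 1 ≤ c₁) {r : ℝ≥0} (hr : r / m ≤ threshold c₁ m) :
    ∫ N, (upperPart α c₁ m ((N : ℝ) / m) - (r / m) ^ α) ^ 2 ∂poissonMeasure r ≤
      4 * (r / m) * rate α m ^ 2 := by
  have hm := h.pos
  have hΔ := h.threshold_pos (by linarith : 0 < c₁)
  have pU := PolyGrowth.upperPart (c₁ := c₁) hα hα2 hm hΔ
  have h1 := integral_sub_sq_le_two_mul pU pU (fun N => le_rfl) r ((r / m) ^ α)
  have h2 := integral_upperPart_sq_le hα hα2 hm hΔ r
  have h3 := h.rpow_sq_le hα (by linarith) (by positivity : 0 ≤ (r : ℝ) / m) (by linarith)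
  have hmΔ : 1 ≤ m * threshold c₁ m := by
    rw [h.mul_threshold]
    exact one_le_mul_of_one_le_of_one_le hc₁ h.one_le_log
  have e : (m ^ α) ^ 2 = m * m ^ (2 * α - 1) := by
    rw [mul_rpow_eq hm.le (by linarith), ← Real.rpow_natCast, ← Real.rpow_mul hm.le, mul_comm α]
    norm_num
  have h4 : (r : ℝ) * (r + 2) ^ (2 * α - 1) / (m ^ α) ^ 2 ≤ r / m * rate α m ^ 2 := by
    rw [e, mul_div_mul_comm, ← Real.div_rpow (by positivity) hm.le]
    gcongr
    refine (Real.rpow_le_rpow (by positivity) ?_ (by linarith)).trans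
      (h.threshold_rpow_le (by linarith))
    rw [div_le_iff₀ hm] at hr ⊢
    linarith
  linarith

/-- The bias alone is too large by (ln m)^{2(α-1)}. Chebyshev bounds the probability of selecting
`upperPart` by 1/ln m, and 2(α-1) ≤ 1. -/
theorem upperPart_bias_small (h : LargeSample α c₁ c₂ m) (hα : 1 < α) (hα2 : α < 3 / 2)
    (hc₁ : 1 ≤ c₁) {r : ℝ≥0} (hr : r / m ≤ threshold c₁ m) :
    |∫ N, upperPart α c₁ m ((N : ℝ) / m) ∂poissonMeasure r - (r / m) ^ α| *
      (poissonMeasure r).real (lowCounts c₁ m)ᶜ ≤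
      2 * (4 * c₁) ^ (α - 1) * (r / m) * rate α m := by
  have hm := h.pos
  have hl := h.log_pos
  have hρ := h.rate_pos
  have hΔ := h.threshold_pos (by linarith : 0 < c₁)
  have hmΔ : Real.log m ≤ m * threshold c₁ m := by
    rw [h.mul_threshold]
    exact le_mul_of_one_le_left hl.le hc₁
  have hr2 : (r : ℝ) ≤ m * threshold c₁ m := by rw [div_le_iff₀ hm] at hr; linarith
  have h1 := integral_upperPart_le hα hα2 hm hΔ r
  have h2 : (r : ℝ) * (r + 1) ^ (α - 1) / m ^ α ≤ r / m * (4 * threshold c₁ m) ^ (α - 1) := by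
    rw [← mul_rpow_eq hm.le (by linarith : α ≠ 0), mul_div_mul_comm,
      ← Real.div_rpow (by positivity) hm.le]
    gcongr
    rw [div_le_iff₀ hm]
    linarith [h.one_le_log]
  have h3 : ((r : ℝ) / m) ^ α ≤ r / m * (4 * threshold c₁ m) ^ (α - 1) := by
    rw [← mul_rpow_eq (by positivity : 0 ≤ (r : ℝ) / m) (by linarith : α ≠ 0)]
    gcongr
    linarith
  have h4 : (poissonMeasure r).real (lowCounts c₁ m)ᶜ ≤ 1 / Real.log m := by
    have hset : (lowCounts c₁ m)ᶜ = {n : ℕ | 2 * (m * threshold c₁ m) < n} := by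
      ext n
      simp [lowCounts]
    rw [hset]
    refine (poisson_real_upper_tail_le r (by positivity) hr2).trans ?_
    gcongr
  have h5 : |∫ N, upperPart α c₁ m ((N : ℝ) / m) ∂poissonMeasure r - (r / m) ^ α| ≤
      2 * (r / m * (4 * threshold c₁ m) ^ (α - 1)) := by
    refine (abs_sub _ _).trans ?_
    rw [abs_of_nonneg (by positivity : 0 ≤ ((r : ℝ) / m) ^ α)]
    linarith
  have h6 : Real.log m ^ (2 * (α - 1)) ≤ Real.log m := by
    conv_rhs => rw [← Real.rpow_one (Real.log m)]
    exact Real.rpow_le_rpow_of_exponent_le h.one_le_log (by linarith)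
  calc _ ≤ 2 * (r / m * (4 * threshold c₁ m) ^ (α - 1)) * (1 / Real.log m) := by gcongr
    _ = 2 * (4 * c₁) ^ (α - 1) * (r / m) * rate α m *
        (Real.log m ^ (2 * (α - 1)) / Real.log m) := by
        rw [h.threshold_rpow_eq (by linarith)]; ring
    _ ≤ _ := mul_le_of_le_one_right (by positivity) (by rwa [div_le_one hl])

theorem log_le_of_threshold_le (h : LargeSample α c₁ c₂ m) (hc₁ : 1 ≤ c₁) {r : ℝ≥0}
    (hr : threshold c₁ m ≤ r / m) : Real.log m ≤ r ∧ m * threshold c₁ m ≤ r := by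
  have h1 : m * threshold c₁ m ≤ r := by
    rw [le_div_iff₀ h.pos] at hr
    linarith
  refine ⟨le_trans ?_ h1, h1⟩
  rw [h.mul_threshold]
  exact le_mul_of_one_le_left h.log_pos.le hc₁

theorem upperPart_bias_large (h : LargeSample α c₁ c₂ m) (hα : 1 < α) (hα2 : α < 3 / 2)
    (hc₁ : 1 ≤ c₁) {r : ℝ≥0} (hr : threshold c₁ m ≤ r / m) :
    |∫ N, upperPart α c₁ m ((N : ℝ) / m) ∂poissonMeasure r - (r / m) ^ α| ≤
      10 * (r / m) * rate α m := by
  have hm := h.pos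
  have hl := h.log_pos
  obtain ⟨hr1, hr2⟩ := h.log_le_of_threshold_le hc₁ hr
  have hr0 : (0 : ℝ) < r := by linarith
  have hr3 : 1 ≤ r := by exact_mod_cast h.one_le_log.trans hr1
  rw [Real.div_rpow r.coe_nonneg hm.le]
  refine (abs_integral_upperPart_sub_le hα hα2 hm (h.threshold_pos (by linarith)) hr3 hr2).trans ?_
  have e1 : (r : ℝ) ^ (α - 1) = r * r ^ (α - 2) := by
    rw [← mul_rpow_eq r.coe_nonneg (by linarith : α - 1 ≠ 0)]
    ring_nf
  have e2 : rate α m = (m ^ (α - 1))⁻¹ * Real.log m ^ (-(α - 1)) := by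
    rw [rate, Real.mul_rpow hm.le hl.le, Real.rpow_neg hm.le]
  -- Here r ≥ ln m, and α - 2 ≤ -(α - 1) is the condition α ≤ 3/2.
  have h1 : (r : ℝ) ^ (α - 2) ≤ Real.log m ^ (-(α - 1)) :=
    (Real.rpow_le_rpow_of_nonpos hl hr1 (by linarith)).trans
      (Real.rpow_le_rpow_of_exponent_le h.one_le_log (by linarith))
  rw [e1, e2, ← mul_rpow_eq hm.le (by linarith : α ≠ 0)]
  calc 10 * (r * (r : ℝ) ^ (α - 2)) / (m * m ^ (α - 1))
      = 10 * (r / m) * ((m ^ (α - 1))⁻¹ * (r : ℝ) ^ (α - 2)) := by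
        field_simp
    _ ≤ _ := by gcongr

theorem upperPart_sq_large (h : LargeSample α c₁ c₂ m) (hα : 1 < α) (hα2 : α < 3 / 2)
    (hc₁ : 1 ≤ c₁) {r : ℝ≥0} (hr : threshold c₁ m ≤ r / m) (hp : r / m ≤ 1) :
    ∫ N, (upperPart α c₁ m ((N : ℝ) / m) - (r / m) ^ α) ^ 2 ∂poissonMeasure r ≤
      44 * (r / m) * rate α m ^ 2 := by
  have hm := h.pos
  obtain ⟨hr1, hr2⟩ := h.log_le_of_threshold_le hc₁ hr
  have hr3 : 1 ≤ r := by exact_mod_cast h.one_le_log.trans hr1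
  have hr0 : (0 : ℝ) < r := by linarith [h.log_pos]
  rw [Real.div_rpow r.coe_nonneg hm.le]
  refine (integral_upperPart_sub_sq_le hα hα2 hm (h.threshold_pos (by linarith)) hr3 hr2).trans ?_
  have e1 : (r : ℝ) ^ (2 * α - 1) = r * r ^ (2 * α - 2) := by
    rw [← mul_rpow_eq r.coe_nonneg (by linarith : 2 * α - 1 ≠ 0)]
    ring_nf
  have e2 : (m ^ α) ^ 2 = m * (m * m ^ (2 * α - 2)) := by
    rw [← Real.rpow_natCast, ← Real.rpow_mul hm.le, show 2 * α - 2 = 2 * α - 1 - 1 by ring,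
      mul_rpow_eq hm.le (by linarith), mul_rpow_eq hm.le (by linarith), mul_comm α]
    norm_num
  have h1 : ((r : ℝ) / m) ^ (2 * α - 2) ≤ 1 := Real.rpow_le_one (by positivity) hp (by linarith)
  rw [Real.div_rpow r.coe_nonneg hm.le] at h1
  rw [e1, e2]
  calc 44 * (r * (r : ℝ) ^ (2 * α - 2)) / (m * (m * m ^ (2 * α - 2)))
      = 44 * (r / m) * ((r : ℝ) ^ (2 * α - 2) / m ^ (2 * α - 2) * (1 / m)) := by
        field_simp
    _ ≤ 44 * (r / m) * (1 * (1 / m)) := by gcongr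
    _ ≤ _ := by
        rw [one_mul]
        gcongr
        exact h.inv_le

/-- Two factors e^{r/32}: 72^K ≤ m^{7/10} with r ≥ 64 ln m, and y^{2K} ≤ e^{2Ky} with 2Ky ≤ r
c₂/(2c₁) ≤ r/32. -/
theorem lowerPoly_sq_large (h : LargeSample α c₁ c₂ m) (hα : 1 < α) (hα₂ : α < 3 / 2)
    (hc₁ : 16 ≤ c₁) (hc₂ : 0 < c₂) (hc₂1 : c₂ ≤ 1) (hc₂' : 10 * c₂ * Real.log 2 < 2 * α - 2)
    {r : ℝ≥0} (hr : 4 * threshold c₁ m ≤ r / m) :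
    ∫ N, lowerPoly α c₁ c₂ m ((N : ℝ) / m) ^ 2 ∂poissonMeasure r ≤
      4 * Real.exp (r / 16) := by
  have hm := h.pos
  have hl := h.log_pos
  have hΔ := h.threshold_pos (by linarith : 0 < c₁)
  have hM : 4 * threshold c₁ m * m = 4 * c₁ * Real.log m := by
    have := h.mul_threshold (c₁ := c₁)
    linarith
  have hrM : 4 * c₁ * Real.log m ≤ r := by
    rw [le_div_iff₀ hm, hM] at hr
    exact hr
  refine (integral_lowerPoly_sq_le_of_ge hm hΔ (by linarith) (h.degree_le (by linarith) hc₂ hc₂1) r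
    (by rw [hM]; exact hrM)).trans ?_
  rw [hM]
  set y : ℝ := r / (4 * c₁ * Real.log m) with hy
  have hy0 : 0 ≤ y := by positivity
  have hK : (approxDegree c₂ m : ℝ) ≤ c₂ * Real.log m := Nat.floor_le (by positivity)
  have h1 : ((4 * threshold c₁ m) ^ α) ^ 2 ≤ 1 :=
    pow_le_one₀ (by positivity) (Real.rpow_le_one (by positivity) h.threshold_le (by linarith))
  have h2 : (72 : ℝ) ^ approxDegree c₂ m ≤ Real.exp (r / 32) := by
    refine (pow_approxDegree_le hα₂ hc₂ hc₂' hm hl.le).trans ?_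
    rw [Real.rpow_def_of_pos hm, Real.exp_le_exp]
    nlinarith
  have h3 : y ^ (2 * approxDegree c₂ m) ≤ Real.exp (r / 32) := by
    have hyexp : y ≤ Real.exp y := by linarith [Real.add_one_le_exp y]
    refine (pow_le_pow_left₀ hy0 hyexp _).trans ?_
    rw [← Real.exp_nat_mul, Real.exp_le_exp]
    push_cast
    calc 2 * (approxDegree c₂ m : ℝ) * y ≤ 2 * (c₂ * Real.log m) * y := by gcongr
      _ = r * (c₂ / (2 * c₁)) := by rw [hy]; field_simp; ring
      _ ≤ r * (1 / 32) := by
          gcongr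
          linarith
      _ = _ := by ring
  calc _ ≤ 1 * (4 * Real.exp (r / 32) * Real.exp (r / 32)) := by gcongr
    _ = _ := by
        rw [one_mul, mul_assoc, ← Real.exp_add]
        ring_nf

/-- The Chernoff bound leaves e^{-r/16} ≤ m^{-2}. One factor 1/m is at most p = r/m, and the other
is at most the squared rate. -/
theorem lower_tail_large (h : LargeSample α c₁ c₂ m) (hc₁ : 16 ≤ c₁) {r : ℝ≥0}
    (hr : 4 * threshold c₁ m ≤ r / m) :
    Real.exp (r / 16) * (poissonMeasure r).real (lowCounts c₁ m) ≤ r / m * rate α m ^ 2 := by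
  have hm := h.pos
  have hl := h.log_pos
  have hmT := h.mul_threshold (c₁ := c₁)
  have hrM : 4 * (m * threshold c₁ m) ≤ r := by
    rw [le_div_iff₀ hm] at hr
    linarith
  have h1 : (poissonMeasure r).real (lowCounts c₁ m) ≤ Real.exp (-(r / 8)) :=
    poisson_real_lower_tail_le r (by linarith)
  have hlr : 32 * Real.log m ≤ r := by
    rw [hmT] at hrM
    nlinarith
  have hr1 : (1 : ℝ) ≤ r := by linarith [h.one_le_log]
  calc _ ≤ Real.exp (r / 16) * Real.exp (-(r / 8)) := by gcongr
    _ ≤ Real.exp (-(Real.log m + Real.log m)) := by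
        rw [← Real.exp_add, Real.exp_le_exp]
        linarith
    _ = 1 / m * (1 / m) := by
        rw [Real.exp_neg, Real.exp_add, Real.exp_log hm]
        field_simp
    _ ≤ r / m * rate α m ^ 2 := by
        gcongr
        exact h.inv_le

theorem lowerPart_sq_large (h : LargeSample α c₁ c₂ m) (hα : 1 < α) (hα₂ : α < 3 / 2)
    (hc₁ : 16 ≤ c₁) (hc₂ : 0 < c₂) (hc₂1 : c₂ ≤ 1) (hc₂' : 10 * c₂ * Real.log 2 < 2 * α - 2)
    {r : ℝ≥0} (hr : 4 * threshold c₁ m ≤ r / m) (hp : r / m ≤ 1) :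
    ∫ N, (lowerPart α c₁ c₂ m ((N : ℝ) / m) - (r / m) ^ α) ^ 2 ∂poissonMeasure r ≤
      10 * Real.exp (r / 16) := by
  have hm := h.pos
  have h1 := integral_sub_sq_le_two_mul (PolyGrowth.lowerPart α c₁ c₂ m)
    (PolyGrowth.lowerPoly α c₁ c₂ m) (fun N => abs_lowerPart_le _ _ _ _ _) r ((r / m) ^ α)
  have h2 := h.lowerPoly_sq_large hα hα₂ hc₁ hc₂ hc₂1 hc₂' hr
  have h3 : (((r : ℝ) / m) ^ α) ^ 2 ≤ 1 :=
    pow_le_one₀ (by positivity) (Real.rpow_le_one (by positivity) hp (by linarith))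
  have h4 : 1 ≤ Real.exp ((r : ℝ) / 16) := Real.one_le_exp (by positivity)
  linarith

theorem lowerPart_bias_large (h : LargeSample α c₁ c₂ m) (hα : 1 < α) (hα₂ : α < 3 / 2)
    (hc₁ : 16 ≤ c₁) (hc₂ : 0 < c₂) (hc₂1 : c₂ ≤ 1) (hc₂' : 10 * c₂ * Real.log 2 < 2 * α - 2)
    {r : ℝ≥0} (hr : 4 * threshold c₁ m ≤ r / m) (hp : r / m ≤ 1) :
    |∫ N, lowerPart α c₁ c₂ m ((N : ℝ) / m) ∂poissonMeasure r - (r / m) ^ α| ≤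
      11 * Real.exp (r / 16) := by
  have h1 := h.lowerPart_sq_large hα hα₂ hc₁ hc₂ hc₂1 hc₂' hr hp
  have pL := (PolyGrowth.lowerPart α c₁ c₂ m).sub (PolyGrowth.const (((r : ℝ) / m) ^ α))
  have h4 : 1 ≤ Real.exp ((r : ℝ) / 16) := Real.one_le_exp (by positivity)
  have h5 : ∫ N, lowerPart α c₁ c₂ m ((N : ℝ) / m) ∂poissonMeasure r - (r / m) ^ α =
      ∫ N, (lowerPart α c₁ c₂ m ((N : ℝ) / m) - (r / m) ^ α) ∂poissonMeasure r := by
    rw [integral_sub ((PolyGrowth.lowerPart α c₁ c₂ m).integrable r) (integrable_const _)]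
    simp
  -- The bias is reduced to the mean squared error by |u| ≤ 1 + u², so 11 = 1 + 10.
  have h6 : ∫ N, (1 + (lowerPart α c₁ c₂ m ((N : ℝ) / m) - (r / m) ^ α) ^ 2) ∂poissonMeasure r =
      1 + ∫ N, (lowerPart α c₁ c₂ m ((N : ℝ) / m) - (r / m) ^ α) ^ 2 ∂poissonMeasure r := by
    rw [integral_add (integrable_const _) ((pL.pow 2).integrable r)]
    simp
  have h7 := abs_integral_le_integral_abs.trans (integral_mono (pL.integrable r).abs
    ((integrable_const (1 : ℝ)).add ((pL.pow 2).integrable r)) fun N => (by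
      simp only [Pi.add_apply]
      nlinarith [sq_abs (lowerPart α c₁ c₂ m ((N : ℝ) / m) - (r / m) ^ α),
        sq_nonneg (|lowerPart α c₁ c₂ m ((N : ℝ) / m) - (r / m) ^ α| - 1)]))
  simp only [Pi.add_apply] at h7
  rw [h6] at h7
  rw [h5]
  linarith

end LargeSample

/-- The bias and the mean squared error of the contribution of a single symbol. -/
theorem exists_symbol_bounds {α c₁ c₂ : ℝ} (hα₁ : 1 < α) (hα₂ : α < 3 / 2)
    (hc₁ : 16 * α < c₁) (hc₂ : 0 < c₂) (hc₂' : 10 * c₂ * Real.log 2 < 2 * α - 2) :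
    ∃ C : ℝ, 0 < C ∧ ∀ m : ℝ, LargeSample α c₁ c₂ m → ∀ r : ℝ≥0, (r : ℝ) / m ≤ 1 →
      |∫ z, symbolEstimator α c₁ c₂ m z ∂(poissonMeasure r).prod (poissonMeasure r) -
        (r / m) ^ α| ≤ C * (r / m) * rate α m ∧
      ∫ z, (symbolEstimator α c₁ c₂ m z - (r / m) ^ α) ^ 2
        ∂(poissonMeasure r).prod (poissonMeasure r) ≤ C * (r / m) * rate α m ^ 2 := by
  obtain ⟨D, hD0, hD⟩ := exists_bestApprox_sub_eval_zero_le hα₁ (by linarith)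
  have hc₁16 : 16 ≤ c₁ := by linarith
  have hc₁1 : 1 ≤ c₁ := by linarith
  have hc₁0 : 0 < c₁ := by linarith
  have hc₂1 : c₂ ≤ 1 := by nlinarith [Real.log_two_gt_d9]
  set C₁ : ℝ := D * (c₂ / 2) ^ (-(2 * (α - 1))) * (4 * c₁) ^ (α - 1) + 4 with hC₁
  set C₂ : ℝ := 2 * (4 * c₁) ^ (α - 1) with hC₂
  have hC₁0 : 0 < C₁ := by positivity
  have hC₂0 : 0 < C₂ := by positivity
  -- 54 = 10 + 44 comes from the mean squared error; the bias needs only 11 + 10 beyond C₁ + C₂.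
  refine ⟨C₁ + C₂ + 54, by positivity, fun m h r hp => ?_⟩
  have hm := h.pos
  have hρ := h.rate_pos
  have hΔ := h.threshold_pos hc₁0
  have hA0 : 0 ≤ (poissonMeasure r).real (lowCounts c₁ m) := measureReal_nonneg
  have hB0 : 0 ≤ (poissonMeasure r).real (lowCounts c₁ m)ᶜ := measureReal_nonneg
  have hA1 : (poissonMeasure r).real (lowCounts c₁ m) ≤ 1 := measureReal_le_one
  have hB1 : (poissonMeasure r).real (lowCounts c₁ m)ᶜ ≤ 1 := measureReal_le_one
  set A := (poissonMeasure r).real (lowCounts c₁ m) with hA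
  set B := (poissonMeasure r).real (lowCounts c₁ m)ᶜ with hB
  have hp0 : 0 ≤ (r : ℝ) / m := by positivity
  set w := (r : ℝ) / m * rate α m with hw
  have hw0 : 0 ≤ w := by positivity
  set w2 := (r : ℝ) / m * rate α m ^ 2 with hw2
  have hw20 : 0 ≤ w2 := by positivity
  have hww : w2 ≤ w := by
    rw [hw, hw2]
    gcongr
    exact h.rate_sq_le hα₁
  -- The lower estimator is split at p = 4Δ and the upper one at p = Δ. Between these points both
  -- are accurate, and no selection probability is needed.
  have hLb : |∫ N, lowerPart α c₁ c₂ m ((N : ℝ) / m) ∂poissonMeasure r - (r / m) ^ α| * A ≤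
      (C₁ + 11) * w := by
    rcases le_total ((r : ℝ) / m) (4 * threshold c₁ m) with hr | hr
    · have h1 := h.lowerPart_bias_small hα₁ hc₁1 hc₂ hc₂1 hD0 hD hr
      rw [← hC₁, mul_assoc, ← hw] at h1
      have h2 := mul_le_of_le_one_right (abs_nonneg (∫ N, lowerPart α c₁ c₂ m ((N : ℝ) / m)
        ∂poissonMeasure r - (r / m) ^ α)) hA1
      linarith
    · have h1 := h.lowerPart_bias_large hα₁ hα₂ hc₁16 hc₂ hc₂1 hc₂' hr hp
      have h2 := h.lower_tail_large hc₁16 hr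
      have h3 := mul_le_mul_of_nonneg_right h1 hA0
      have h4 : 0 ≤ C₁ * w := by positivity
      linarith
  have hLs : (∫ N, (lowerPart α c₁ c₂ m ((N : ℝ) / m) - (r / m) ^ α) ^ 2 ∂poissonMeasure r) * A ≤
      10 * w2 := by
    rcases le_total ((r : ℝ) / m) (4 * threshold c₁ m) with hr | hr
    · have h1 := h.lowerPart_sq_small hα₁ hc₁1 hc₂ hc₂1 hr
      have h2 := mul_le_of_le_one_right (integral_nonneg (μ := poissonMeasure r) fun N =>
        sq_nonneg (lowerPart α c₁ c₂ m ((N : ℝ) / m) - (r / m) ^ α)) hA1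
      linarith
    · have h1 := h.lowerPart_sq_large hα₁ hα₂ hc₁16 hc₂ hc₂1 hc₂' hr hp
      have h2 := h.lower_tail_large hc₁16 hr
      have h3 := mul_le_mul_of_nonneg_right h1 hA0
      linarith
  have hUb : |∫ N, upperPart α c₁ m ((N : ℝ) / m) ∂poissonMeasure r - (r / m) ^ α| * B ≤
      (C₂ + 10) * w := by
    rcases le_total ((r : ℝ) / m) (threshold c₁ m) with hr | hr
    · have h1 := h.upperPart_bias_small hα₁ hα₂ hc₁1 hr
      rw [← hC₂, mul_assoc, ← hw] at h1
      linarith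
    · have h1 := h.upperPart_bias_large hα₁ hα₂ hc₁1 hr
      have h2 := mul_le_of_le_one_right (abs_nonneg (∫ N, upperPart α c₁ m ((N : ℝ) / m)
        ∂poissonMeasure r - (r / m) ^ α)) hB1
      have h4 : 0 ≤ C₂ * w := by positivity
      linarith
  have hUs : (∫ N, (upperPart α c₁ m ((N : ℝ) / m) - (r / m) ^ α) ^ 2 ∂poissonMeasure r) * B ≤
      44 * w2 := by
    have h2 := mul_le_of_le_one_right (integral_nonneg (μ := poissonMeasure r) fun N =>
      sq_nonneg (upperPart α c₁ m ((N : ℝ) / m) - (r / m) ^ α)) hB1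
    rcases le_total ((r : ℝ) / m) (threshold c₁ m) with hr | hr
    · have h1 := h.upperPart_sq_small hα₁ hα₂ hc₁1 hr
      linarith
    · have h1 := h.upperPart_sq_large hα₁ hα₂ hc₁1 hr hp
      linarith
  rw [mul_assoc, mul_assoc, ← hw, ← hw2]
  constructor
  · rw [integral_symbolEstimator_sub hα₁ hα₂ hm hΔ]
    refine (abs_add_le _ _).trans ?_
    rw [abs_mul, abs_mul, abs_of_nonneg hA0, abs_of_nonneg hB0]
    linarith
  · rw [(integral_symbolEstimator_sub_sq hα₁ hα₂ hm hΔ r _).2]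
    have h4 : 0 ≤ C₁ * w2 := by positivity
    have h5 : 0 ≤ C₂ * w2 := by positivity
    linarith

/-- The uniform risk bound. -/
theorem exists_risk_le {α c₁ c₂ : ℝ} (hα₁ : 1 < α) (hα₂ : α < 3 / 2)
    (hc₁ : 16 * α < c₁) (hc₂ : 0 < c₂) (hc₂' : 10 * c₂ * Real.log 2 < 2 * α - 2) :
    ∃ C : ℝ, 0 < C ∧ ∀ n : ℕ, LargeSample α c₁ c₂ ((n : ℝ) / 2) → ∀ (S : ℕ) (P : Fin S → ℝ),
      P ∈ stdSimplex ℝ (Fin S) →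
      risk α c₁ c₂ n P ≤ ENNReal.ofReal (C * rate α ((n : ℝ) / 2) ^ 2) := by
  obtain ⟨C, hC0, hC⟩ := exists_symbol_bounds hα₁ hα₂ hc₁ hc₂ hc₂'
  -- C is the sum of the mean squared errors and C² the square of the summed biases, both using ∑ P
  -- i = 1.
  refine ⟨C + C ^ 2, by positivity, fun n h S P hP => ?_⟩
  have hm := h.pos
  set m : ℝ := (n : ℝ) / 2 with hmdef
  have hr : ∀ i, (((n : ℝ≥0) * (P i).toNNReal / 2 : ℝ≥0) : ℝ) / m = P i := by
    intro i
    push_cast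
    rw [Real.coe_toNNReal _ (hP.1 i), hmdef]
    have : (n : ℝ) ≠ 0 := by
      intro h0
      rw [hmdef, h0] at hm
      norm_num at hm
    field_simp
  have hP1 : ∀ i, P i ≤ 1 := fun i => by
    rw [← hP.2]
    exact Finset.single_le_sum (fun j _ => hP.1 j) (Finset.mem_univ i)
  have hb := fun i => hC m h ((n : ℝ≥0) * (P i).toNNReal / 2) (by rw [hr i]; exact hP1 i)
  simp only [hr] at hb
  refine (risk_le_of_symbol_bounds
    (memLp_symbolEstimator hα₁ hα₂ hm (h.threshold_pos (by linarith)))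
    (fun i => C * P i * rate α m) (fun i => C * P i * rate α m ^ 2) (fun i => (hb i).1)
    fun i => (hb i).2).trans (ENNReal.ofReal_le_ofReal (le_of_eq ?_))
  rw [← Finset.sum_mul, ← Finset.sum_mul, ← Finset.mul_sum, hP.2]
  ring

/-- Passing from n to m = n/2 costs a constant: n = 2m and ln n ≤ 2 ln m, so n ln n ≤ 4 m ln m. -/
theorem rpow_mul_rate_sq_le {α c₁ c₂ x : ℝ} (hα : 1 < α) (h : LargeSample α c₁ c₂ (x / 2)) :
    (x * Real.log x) ^ (2 * (α - 1)) * rate α (x / 2) ^ 2 ≤ 4 ^ (2 * (α - 1)) := by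
  have hm := h.pos
  have hl := h.log_pos
  have hx : x = 2 * (x / 2) := by ring
  set m := x / 2
  have hlog : Real.log x ≤ 2 * Real.log m := by
    rw [hx, Real.log_mul two_ne_zero hm.ne']
    have := Real.log_two_lt_d9
    linarith [h.one_le_log]
  have hlx : 0 ≤ Real.log x := by
    rw [hx, Real.log_mul two_ne_zero hm.ne']
    have := Real.log_two_gt_d9
    linarith
  have e : rate α m ^ 2 = ((m * Real.log m) ^ (2 * (α - 1)))⁻¹ := by
    rw [rate, ← Real.rpow_natCast, ← Real.rpow_mul (by positivity), ← Real.rpow_neg (by positivity)]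
    push_cast
    ring_nf
  rw [e, ← div_eq_mul_inv, div_le_iff₀ (by positivity), ← Real.mul_rpow (by norm_num) (by positivity)]
  refine Real.rpow_le_rpow (mul_nonneg (by linarith) hlx) ?_ (by linarith)
  calc x * Real.log x ≤ x * (2 * Real.log m) := by
        gcongr
        linarith
    _ = 4 * (m * Real.log m) := by rw [hx]; ring

end PowerSumEstimation

end

theorem theorem3 (α c₁ c₂ : ℝ) (hα₁ : 1 < α) (hα₂ : α < 3 / 2)
    (hc₁ : 16 * α < c₁) (hc₂ : 0 < c₂) (hc₂' : 10 * c₂ * Real.log 2 < 2 * α - 2) :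
    limsup (fun n : ℕ =>
        ENNReal.ofReal (((n : ℝ) * Real.log n) ^ (2 * (α - 1))) *
          ⨆ (S : ℕ) (P : Fin S → ℝ) (_ : P ∈ stdSimplex ℝ (Fin S)),
            PowerSumEstimation.risk α c₁ c₂ n P) atTop < ⊤ := by
  obtain ⟨C, hC0, hC⟩ := PowerSumEstimation.exists_risk_le hα₁ hα₂ hc₁ hc₂ hc₂'
  have hev : ∀ᶠ n : ℕ in atTop, PowerSumEstimation.LargeSample α c₁ c₂ ((n : ℝ) / 2) :=
    (tendsto_natCast_atTop_atTop.atTop_div_const two_pos).eventually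
      (PowerSumEstimation.eventually_largeSample hα₁ hα₂ hc₁ hc₂ hc₂')
  refine (limsup_le_of_le (a := ENNReal.ofReal (C * 4 ^ (2 * (α - 1)))) (by isBoundedDefault)
    ?_).trans_lt ENNReal.ofReal_lt_top
  filter_upwards [hev] with n h
  have hsup : ⨆ (S : ℕ) (P : Fin S → ℝ) (_ : P ∈ stdSimplex ℝ (Fin S)),
      PowerSumEstimation.risk α c₁ c₂ n P ≤
        ENNReal.ofReal (C * PowerSumEstimation.rate α ((n : ℝ) / 2) ^ 2) :=
    iSup_le fun S => iSup_le fun P => iSup_le fun hP => hC n h S P hP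
  refine (mul_le_mul_right hsup _).trans ?_
  rw [← ENNReal.ofReal_mul' (by positivity)]
  refine ENNReal.ofReal_le_ofReal ?_
  have h1 := mul_le_mul_of_nonneg_left (PowerSumEstimation.rpow_mul_rate_sq_le hα₁ h) hC0.le
  linarith
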